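/- Let $N,K_A,K_B,M$ be non-negative integers with $N\le M$, $K_A\le K_B\le M$, let $\gamma>0$, $\gamma\neq1$, and let $C>0$. In the Statistical game $\mathrm{SGame}(N,K_A,K_B,M,\gamma)$ Player 2 chooses a scenario A or B and a binary sequence of length $M$ with exactly $K_A$, respectively $K_B$, ones. Player 1, without knowing this choice, chooses $N$ of the $M$ positions, observes the bits there, and depending on them places a portion $p'\in[0,1]$ of her capital $C$ on A and the portion $1-p'$ on B. The portion placed on the chosen scenario is doubled, the rest is lost. The game is zero-sum in utilities; Player 1's utility of a final capital $c$ is $u_\gamma(c)=\frac{c^{1-\gamma}-1}{1-\gamma}$ (with $u_\gamma(0)=-\infty$ if $\gamma>1$), and mixed strategies are arbitrary probability distributions on the players' pure actions (for Player 1, pairs of an $N$-element set of positions and a policy mapping each sample in $\{0,1\}^N$ to a portion in $[0,1]$). Put, for $0\le k\le N$, $$p_k(A)=\frac{\binom{K_A}{k}\binom{M-K_A}{N-k}}{\binom MN},\qquad p_k(B)=\frac{\binom{K_B}{k}\binom{M-K_B}{N-k}}{\binom MN},$$ and let $\mathbb K_A$, $\mathbb K_B$ be the sets of $k$ with $p_k(A)>0$,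 respectively $p_k(B)>0$. Assume $\mathbb K_A\cap\mathbb K_B\neq\emptyset$ (the sample does not always reveal the scenario). For $P\in[0,1]$ let $$p'_k(P)=\frac{(P\,p_k(A))^{1/\gamma}}{(P\,p_k(A))^{1/\gamma}+((1-P)\,p_k(B))^{1/\gamma}},$$ $$U_\gamma(P)=P\sum_k p_k(A)\,u_\gamma(p'_k(P))+(1-P)\sum_k p_k(B)\,u_\gamma(1-p'_k(P)),$$ with the conventions $0/0=0$ and $0\cdot(-\infty)=0$. For $P\in[0,1]$ and $q=(q_k)_k$ with $q_k\in[0,1]$, let $(P,q)$ denote the symmetric strategy profile in which Player 2 chooses A with probability $P$ and B with probability $1-P$ and then an allowed sequence uniformly, while Player 1 samples $N$ positions uniformly and, on seeing $k$ ones, places the portion $q_k$ on A and $1-q_k$ on B. Then there is $P^*_\gamma\in(0,1)$ such that: 1. $P^*_\gamma$ is the unique minimiser of $U_\gamma$ on $[0,1]$; moreover, for every $P\in[0,1]$, Player 1's expected utility in the profile $(P,(p'_k(P))_k)$ is $(2C)^{1-\gamma}U_\gamma(P)+u_\gamma(2C)$ (so it is $U_\gamma(P)$ when capital is measured in units of $2C$).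 2. The game has a unique Nash equilibrium of the symmetric form, with parameters $P^*_\gamma$ and $p'_k(P^*_\gamma)$: the profile $(P,q)$ is a Nash equilibrium (against all deviations in mixed strategies) if and only if $P=P^*_\gamma$ and $q_k=p'_k(P^*_\gamma)$ for every $k\in\mathbb K_A\cup\mathbb K_B$. 3. Every Nash equilibrium in mixed strategies, symmetric or not, has the same parameters: in it Player 2 chooses A with probability $P^*_\gamma$, and with probability one Player 1's policy assigns the portion $p'_k(P^*_\gamma)$ to every sample having $k\in\mathbb K_A\cup\mathbb K_B$ ones. -/

import Mathlib

open MeasureTheory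
open scoped ENNReal

noncomputable section

namespace StatisticalGame

/-- The number of `1`-s (black squares) in a binary sequence. -/
def ones {n : ℕ} (b : Fin n → Bool) : ℕ :=
  (Finset.univ.filter (fun i => b i = true)).card

/-- Binary sequences of length `M` with exactly `K` ones. -/
abbrev Sequences (M K : ℕ) : Type := {b : Fin M → Bool // ones b = K}

/-- The samplings: sets of `N` indices among the `M` positions. -/
def Sampling (M N : ℕ) : Type := {S : Finset (Fin M) // S.card = N}

instance (M N : ℕ) : Fintype (Sampling M N) :=
  inferInstanceAs (Fintype {S : Finset (Fin M) // S.card = N})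

instance (M N : ℕ) : MeasurableSpace (Sampling M N) := ⊤

/-- The `N` bits seen by Player 1 when she samples the index set `S`, in increasing order of
the indices. -/
def observe {M N : ℕ} (S : Sampling M N) (b : Fin M → Bool) : Fin N → Bool :=
  fun i => b (S.1.orderEmbOfFin S.2 i)

/-- A (pure) policy of Player 1: to each observed sample, the portion of her capital that she
places on scenario A. -/
abbrev Policy (N : ℕ) : Type := (Fin N → Bool) → unitInterval

/-- Pure actions of Player 1: an index set to sample and a policy. -/
abbrev Action₁ (N M : ℕ) : Type := Sampling M N × Policy N

/-- Pure actions of Player 2: scenario A with a sequence having `KA` ones (`Sum.inl`), or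
scenario B with a sequence having `KB` ones (`Sum.inr`). -/
abbrev Action₂ (KA KB M : ℕ) : Type := Sequences M KA ⊕ Sequences M KB

/-- The isoelastic utility `u_γ(c) = (c ^ (1 - γ) - 1) / (1 - γ)` of a capital `c ≥ 0`; for
`γ > 1` its value at `c = 0` is `-∞`. -/
def isoelasticUtility (γ c : ℝ) : EReal :=
  if c = 0 ∧ 1 < γ then ⊥ else (((c ^ (1 - γ) - 1) / (1 - γ) : ℝ) : EReal)

/-- The payoff of Player 1 with initial capital `C`: the portion placed on the scenario that
Player 2 has chosen is doubled and the rest is lost. -/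
def payoff {N KA KB M : ℕ} (γ C : ℝ) (a₁ : Action₁ N M) : Action₂ KA KB M → EReal
  | Sum.inl b => isoelasticUtility γ (2 * C * (a₁.2 (observe a₁.1 b.1) : ℝ))
  | Sum.inr b => isoelasticUtility γ (2 * C * (1 - (a₁.2 (observe a₁.1 b.1) : ℝ)))

/-- Expectation of an extended real valued function: the integral of the positive part minus the
integral of the negative part. (All payoffs of the game are bounded above.) -/
def expectation {α : Type*} [MeasurableSpace α] (μ : Measure α) (f : α → EReal) : EReal :=
  ((∫⁻ x, (f x).toENNReal ∂μ : ℝ≥0∞) : EReal) - ((∫⁻ x, (-f x).toENNReal ∂μ : ℝ≥0∞) : EReal)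

/-- Player 1's expected utility, when she plays the mixed strategy `σ₁` (a probability measure on
her actions) and Player 2 plays the mixed strategy `σ₂` (a probability vector on her actions).
In `EReal` one has `0 * ⊥ = 0`, so actions that are not played do not contribute. -/
def expectedUtility {N KA KB M : ℕ} (γ C : ℝ) (σ₁ : Measure (Action₁ N M))
    (σ₂ : Action₂ KA KB M → ℝ) : EReal :=
  ∑ a₂, ((σ₂ a₂ : ℝ) : EReal) * expectation σ₁ (fun a₁ => payoff γ C a₁ a₂)

/-- Nash equilibria in mixed strategies of the zero-sum game with parameters `N`, `KA`, `KB`, `M`,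
`γ` and initial capital `C`. All deviations are allowed, symmetric or not. -/
structure IsNashEquilibrium {N KA KB M : ℕ} (γ C : ℝ) (σ₁ : Measure (Action₁ N M))
    (σ₂ : Action₂ KA KB M → ℝ) : Prop where
  isProbabilityMeasure : IsProbabilityMeasure σ₁
  mem_stdSimplex : σ₂ ∈ stdSimplex ℝ (Action₂ KA KB M)
  optimal₁ : ∀ σ₁' : Measure (Action₁ N M), IsProbabilityMeasure σ₁' →
    expectedUtility γ C σ₁' σ₂ ≤ expectedUtility γ C σ₁ σ₂
  optimal₂ : ∀ σ₂' ∈ stdSimplex ℝ (Action₂ KA KB M),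
    expectedUtility γ C σ₁ σ₂ ≤ expectedUtility γ C σ₁ σ₂'

/-- Player 1 samples `N` indices uniformly and places the portion `q k` on A, where `k` is the
number of ones in her sample. -/
def symmetricStrategy₁ (N M : ℕ) (q : ℕ → unitInterval) : Measure (Action₁ N M) :=
  (Fintype.card (Sampling M N) : ℝ≥0∞)⁻¹ •
    ∑ S : Sampling M N, Measure.dirac (S, fun d => q (ones d))

/-- Player 2 chooses scenario A with probability `P` and B with probability `1 - P`, and then an
allowed sequence uniformly. -/
def symmetricStrategy₂ (KA KB M : ℕ) (P : unitInterval) : Action₂ KA KB M → ℝ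
  | Sum.inl _ => (P : ℝ) / Fintype.card (Sequences M KA)
  | Sum.inr _ => (1 - (P : ℝ)) / Fintype.card (Sequences M KB)

/-- The probability that Player 2 chooses scenario A. -/
def probScenarioA {KA KB M : ℕ} (σ₂ : Action₂ KA KB M → ℝ) : ℝ :=
  ∑ b : Sequences M KA, σ₂ (Sum.inl b)

/-- Hypergeometric probability of `k` ones among `N` (`k ≤ N`) bits sampled from `M` bits of
which `K` are ones. -/
def hypergeom (N K M k : ℕ) : ℝ :=
  ((K.choose k : ℝ) * ((M - K).choose (N - k) : ℝ)) / (M.choose N : ℝ)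

lemma hypergeom_nonneg (N K M k : ℕ) : 0 ≤ hypergeom N K M k := by
  unfold hypergeom; positivity

/-- The possible numbers of ones in a sample of size `N` from a sequence of length `M` with `K`
ones: `max (0, N - (M - K)), …, min (K, N)`. -/
def reachable (N K M : ℕ) : Finset ℕ := Finset.Icc (N - (M - K)) (min K N)

/-- `p'_k(P) = (P p_k(A))^(1/γ) / ((P p_k(A))^(1/γ) + ((1 - P) p_k(B))^(1/γ))`. -/
def splittingRatio (N KA KB M : ℕ) (γ : ℝ) (P : unitInterval) (k : ℕ) : unitInterval :=
  ⟨((P : ℝ) * hypergeom N KA M k) ^ (1 / γ) /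
      (((P : ℝ) * hypergeom N KA M k) ^ (1 / γ) +
        ((1 - (P : ℝ)) * hypergeom N KB M k) ^ (1 / γ)), by
    have h₁ : 0 ≤ ((P : ℝ) * hypergeom N KA M k) ^ (1 / γ) :=
      Real.rpow_nonneg (mul_nonneg P.2.1 (hypergeom_nonneg _ _ _ _)) _
    have h₂ : 0 ≤ ((1 - (P : ℝ)) * hypergeom N KB M k) ^ (1 / γ) :=
      Real.rpow_nonneg (mul_nonneg (sub_nonneg.2 P.2.2) (hypergeom_nonneg _ _ _ _)) _
    exact ⟨div_nonneg h₁ (add_nonneg h₁ h₂), div_le_one_of_le₀ (by linarith) (add_nonneg h₁ h₂)⟩⟩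

/-- `U_γ(P) = P ∑_k p_k(A) u_γ(p'_k(P)) + (1 - P) ∑_k p_k(B) u_γ(1 - p'_k(P))`, with the convention
`0 · (-∞) = 0`. -/
def equilibriumUtility (N KA KB M : ℕ) (γ : ℝ) (P : unitInterval) : EReal :=
  ((P : ℝ) : EReal) * ∑ k ∈ Finset.range (N + 1), ((hypergeom N KA M k : ℝ) : EReal) *
      isoelasticUtility γ (splittingRatio N KA KB M γ P k : ℝ) +
    ((1 - (P : ℝ) : ℝ) : EReal) * ∑ k ∈ Finset.range (N + 1), ((hypergeom N KB M k : ℝ) : EReal) *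
      isoelasticUtility γ (1 - (splittingRatio N KA KB M γ P k : ℝ))

end StatisticalGame

end

namespace StatisticalGame

/-! Each payoff is a constant minus `(2C)^(1-γ)` times a loss in `[0, ∞]`, so equilibria are saddle
points of the expected loss, which Player 1 minimises and Player 2 maximises
(`isNashEquilibrium_iff`). Since losses are nonnegative, infinite utilities need no separate
treatment.

Uniform randomisation removes the combinatorics. Against a uniform sampler only the probability of A
matters (`expectedLoss_symmetricStrategy₁`). Against uniform sequences only the policy matters, and
its loss is a sum over samples of independent one-variable problems
(`expectedLoss_symmetricStrategy₂`). Each of these has a unique minimiser, the splitting ratio, as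
soon as one of its weights is positive (`splitLoss_optimalRatio_lt`).

Let `L(P, q)` be the loss of the symmetric profile, affine in `P`, and let `F(P) = min_q L(P, q)`,
attained at `q_P`, the splitting ratios at `P`. `F` is continuous, vanishes at 0 and 1, and is
positive in between because some count is possible in both scenarios; so it has an interior maximum
`P*`. An envelope argument shows that `q_{P*}` loses equally in both scenarios (`lossA_eq_lossB`),
hence `L(Q, q_{P*}) = F(P*)` for all `Q`. At a common count `q_Q` determines `Q`, so `F(Q) < L(Q,
q_{P*}) = F(P*)` for `Q ≠ P*`: the maximum is unique.

If `(σ₁, σ₂)` is an equilibrium in which A has probability `Q`, then for every `q` `F(P*) ≤ loss(σ₁,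
uniform P*) ≤ loss(σ₁, σ₂) ≤ loss(uniform q, σ₂) = L(Q, q)`. Taking `q = q_Q` forces `Q = P*`;
taking `q = q_{P*}` gives equality throughout, so almost every policy solves all the one-variable
problems (`IsNashEquilibrium.parameters`). -/

/-! ### The one-variable problem: isoelastic loss and the optimal split. -/

/-- The loss of utility `-u_γ(q)` caused by holding the fraction `q` of the maximal capital. -/
noncomputable def loss (γ q : ℝ) : ℝ≥0∞ :=
  if q = 0 ∧ 1 < γ then ⊤ else ENNReal.ofReal ((1 - q ^ (1 - γ)) / (1 - γ))

/-- The fraction minimising `splitLoss`. -/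
noncomputable def optimalRatio (γ x y : ℝ) : ℝ :=
  x ^ (1 / γ) / (x ^ (1 / γ) + y ^ (1 / γ))

/-- The total loss when the fractions `q` and `1 - q` carry the weights `x` and `y`. -/
noncomputable def splitLoss (γ x y q : ℝ) : ℝ≥0∞ :=
  ENNReal.ofReal x * loss γ q + ENNReal.ofReal y * loss γ (1 - q)

/-- The isoelastic utility lies strictly below its tangent at `1`. -/
lemma isoelastic_lt_sub_one {γ t : ℝ} (hγ : 0 < γ) (hγ1 : γ ≠ 1) (ht : 0 ≤ t) (ht1 : t ≠ 1)
    (h : ¬ (t = 0 ∧ 1 < γ)) : (t ^ (1 - γ) - 1) / (1 - γ) < t - 1 := by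
  rcases lt_or_gt_of_ne hγ1 with hlt | hgt
  -- For `γ < 1` this is the strict Bernoulli inequality with exponent `1 - γ` in `(0, 1)`.
  · have := rpow_one_add_lt_one_add_mul_self (s := t - 1) (by linarith)
      (sub_ne_zero.2 ht1) (p := 1 - γ) (by linarith) (by linarith)
    rw [add_sub_cancel] at this
    rw [div_lt_iff₀ (by linarith)]
    linarith
  -- The excluded point matters: with the default value `0 ^ (1 - γ) = 0` the left side would be
  -- positive at `t = 0`.
  · have ht0 : 0 < t := lt_of_le_of_ne ht fun h0 => h ⟨h0.symm, hgt⟩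
    have h1 := Real.log_lt_sub_one_of_pos ht0 ht1
    have h2 := Real.add_one_le_exp (Real.log t * (1 - γ))
    rw [← Real.rpow_def_of_pos ht0] at h2
    rw [div_lt_iff_of_neg (by linarith)]
    nlinarith

lemma loss_of_not {γ q : ℝ} (h : ¬ (q = 0 ∧ 1 < γ)) :
    loss γ q = ENNReal.ofReal ((1 - q ^ (1 - γ)) / (1 - γ)) := if_neg h

lemma loss_one (γ : ℝ) : loss γ 1 = 0 := by simp [loss]

lemma real_loss_lower {γ q : ℝ} (hγ : 0 < γ) (hγ1 : γ ≠ 1) (hq : 0 ≤ q)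
    (h : ¬ (q = 0 ∧ 1 < γ)) : 1 - q ≤ (1 - q ^ (1 - γ)) / (1 - γ) := by
  rcases eq_or_ne q 1 with rfl | hq1
  · simp
  · have := isoelastic_lt_sub_one hγ hγ1 hq hq1 h
    have e : (1 - q ^ (1 - γ)) / (1 - γ) = -((q ^ (1 - γ) - 1) / (1 - γ)) := by ring
    linarith

lemma loss_pos {γ q : ℝ} (hγ : 0 < γ) (hγ1 : γ ≠ 1) (hq : 0 ≤ q) (hq1 : q < 1) :
    0 < loss γ q := by
  by_cases h : q = 0 ∧ 1 < γ
  · simp [loss, h]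
  · rw [loss_of_not h, ENNReal.ofReal_pos]
    linarith [real_loss_lower hγ hγ1 hq h]

/-- The isoelastic utility lies strictly below its tangents. -/
lemma isoelastic_lt_tangent {γ r q : ℝ} (hγ : 0 < γ) (hγ1 : γ ≠ 1) (hr : 0 < r) (hq : 0 ≤ q)
    (hqr : q ≠ r) (h : ¬ (q = 0 ∧ 1 < γ)) :
    (1 - r ^ (1 - γ)) / (1 - γ) - r ^ (-γ) * (q - r) < (1 - q ^ (1 - γ)) / (1 - γ) := by
  have hne : 1 - γ ≠ 0 := sub_ne_zero.2 hγ1.symm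
  -- By homogeneity, the tangent at `r` is the tangent at `1` evaluated at `q / r` and scaled by `r
  -- ^ (1 - γ)`.
  have ht := isoelastic_lt_sub_one (t := q / r) hγ hγ1 (by positivity)
    (by rwa [Ne, div_eq_one_iff_eq hr.ne']) (by simpa [hr.ne'] using h)
  have hpos : 0 < r ^ (1 - γ) := Real.rpow_pos_of_pos hr _
  have h1 := mul_lt_mul_of_pos_left ht hpos
  rw [Real.div_rpow hq hr.le] at h1
  have e1 : r ^ (1 - γ) = r * r ^ (-γ) := by
    rw [sub_eq_add_neg, Real.rpow_add hr, Real.rpow_one]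
  have e2 : r ^ (1 - γ) * ((q ^ (1 - γ) / r ^ (1 - γ) - 1) / (1 - γ)) =
      (1 - r ^ (1 - γ)) / (1 - γ) - (1 - q ^ (1 - γ)) / (1 - γ) := by
    field_simp; ring
  have e3 : r ^ (1 - γ) * (q / r - 1) = r ^ (-γ) * (q - r) := by
    rw [e1]; field_simp
  rw [e2, e3] at h1
  linarith

/-- Includes `y = 0`, where the ratio is `0 / 0 = 0`; this is why only `optimalRatio_right_zero`
needs a positive weight. -/
lemma optimalRatio_left_zero {γ y : ℝ} (hγ : 0 < γ) : optimalRatio γ 0 y = 0 := by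
  simp [optimalRatio, hγ.ne']

lemma optimalRatio_right_zero {γ x : ℝ} (hγ : 0 < γ) (hx : 0 < x) : optimalRatio γ x 0 = 1 := by
  have : 0 < x ^ (1 / γ) := Real.rpow_pos_of_pos hx _
  rw [optimalRatio, Real.zero_rpow (by positivity), add_zero, div_self this.ne']

lemma rpow_sum_pos {γ x y : ℝ} (hx : 0 ≤ x) (hy : 0 ≤ y) (h : 0 < x + y) :
    0 < x ^ (1 / γ) + y ^ (1 / γ) := by
  rcases hx.eq_or_lt with rfl | hx'
  · have := Real.rpow_pos_of_pos (x := y) (by linarith) (1 / γ)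
    have := Real.rpow_nonneg hx (1 / γ)
    linarith
  · have := Real.rpow_pos_of_pos hx' (1 / γ)
    have := Real.rpow_nonneg hy (1 / γ)
    linarith

lemma one_sub_optimalRatio {γ x y : ℝ} (hx : 0 ≤ x) (hy : 0 ≤ y) (h : 0 < x + y) :
    1 - optimalRatio γ x y = optimalRatio γ y x := by
  have := rpow_sum_pos (γ := γ) hx hy h
  rw [optimalRatio, optimalRatio, add_comm (y ^ (1 / γ))]
  field_simp; ring

lemma optimalRatio_pos {γ x y : ℝ} (hx : 0 < x) (hy : 0 ≤ y) : 0 < optimalRatio γ x y :=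
  div_pos (Real.rpow_pos_of_pos hx _) (rpow_sum_pos hx.le hy (by linarith))

lemma optimalRatio_lt_one {γ x y : ℝ} (hx : 0 ≤ x) (hy : 0 < y) : optimalRatio γ x y < 1 := by
  have := one_sub_optimalRatio (γ := γ) hx hy.le (by linarith)
  have := optimalRatio_pos (γ := γ) hy hx
  linarith

/-- First order condition for the optimal ratio. -/
lemma mul_optimalRatio_rpow {γ x y : ℝ} (hγ : 0 < γ) (hx : 0 < x) (hy : 0 ≤ y) :
    x * optimalRatio γ x y ^ (-γ) = (x ^ (1 / γ) + y ^ (1 / γ)) ^ γ := by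
  have h1 := rpow_sum_pos (γ := γ) hx.le hy (by linarith)
  rw [optimalRatio, Real.div_rpow (Real.rpow_nonneg hx.le _) h1.le, ← Real.rpow_mul hx.le,
    Real.rpow_neg h1.le]
  have : 1 / γ * -γ = -1 := by field_simp
  rw [this, Real.rpow_neg_one]
  field_simp

lemma splitLoss_of_pos {γ x y q : ℝ} (hγ : 0 < γ) (hγ1 : γ ≠ 1) (hx : 0 ≤ x) (hy : 0 ≤ y)
    (hq0 : 0 ≤ q) (hq1 : q ≤ 1) (h : ¬ (q = 0 ∧ 1 < γ)) (h' : ¬ (1 - q = 0 ∧ 1 < γ)) :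
    splitLoss γ x y q = ENNReal.ofReal (x * ((1 - q ^ (1 - γ)) / (1 - γ)) +
      y * ((1 - (1 - q) ^ (1 - γ)) / (1 - γ))) := by
  have h1 := real_loss_lower hγ hγ1 hq0 h
  have h2 := real_loss_lower hγ hγ1 (sub_nonneg.2 hq1) h'
  rw [splitLoss, loss_of_not h, loss_of_not h', ← ENNReal.ofReal_mul hx, ← ENNReal.ofReal_mul hy,
    ENNReal.ofReal_add]
  · exact mul_nonneg hx (by linarith)
  · exact mul_nonneg hy (by linarith)

/-- Both losses lie strictly above their tangents at the optimal ratio, and the weighted slopes of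
these tangents cancel. If one weight vanishes, the ratio is 0 or 1 and the only remaining term is
zero exactly there. -/
lemma splitLoss_optimalRatio_lt {γ x y q : ℝ} (hγ : 0 < γ) (hγ1 : γ ≠ 1) (hx : 0 ≤ x) (hy : 0 ≤ y)
    (hxy : 0 < x + y) (hq0 : 0 ≤ q) (hq1 : q ≤ 1) (hq : q ≠ optimalRatio γ x y) :
    splitLoss γ x y (optimalRatio γ x y) < splitLoss γ x y q := by
  rcases hx.eq_or_lt with rfl | hx'
  · rw [zero_add] at hxy
    rw [optimalRatio_left_zero hγ] at *
    have := lt_of_le_of_ne hq0 hq.symm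
    simp only [splitLoss, ENNReal.ofReal_zero, zero_mul, zero_add, sub_zero, loss_one, mul_zero]
    exact ENNReal.mul_pos (by simpa using hxy)
      (loss_pos hγ hγ1 (by linarith) (by linarith)).ne'
  rcases hy.eq_or_lt with rfl | hy'
  · rw [optimalRatio_right_zero hγ hx'] at *
    have := lt_of_le_of_ne hq1 hq
    simp only [splitLoss, ENNReal.ofReal_zero, zero_mul, add_zero, loss_one, mul_zero]
    exact ENNReal.mul_pos (by simpa using hx') (loss_pos hγ hγ1 hq0 this).ne'
  have hr0 := optimalRatio_pos (γ := γ) hx' hy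
  have hr1 := optimalRatio_lt_one (γ := γ) hx hy'
  have e1 := mul_optimalRatio_rpow hγ hx' hy
  have e2 := mul_optimalRatio_rpow hγ hy' hx
  rw [← one_sub_optimalRatio hx hy hxy, add_comm] at e2
  set r := optimalRatio γ x y
  rw [splitLoss_of_pos hγ hγ1 hx hy hr0.le hr1.le (by simp [hr0.ne'])
    (by simp [(sub_pos.2 hr1).ne'])]
  by_cases h : q = 0 ∧ 1 < γ
  · simp [splitLoss, loss, h, ENNReal.mul_top, hx']
  by_cases h' : 1 - q = 0 ∧ 1 < γ
  · simp [splitLoss, loss, h', ENNReal.mul_top, hy']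
  rw [splitLoss_of_pos hγ hγ1 hx hy hq0 hq1 h h']
  have t1 := mul_lt_mul_of_pos_left (isoelastic_lt_tangent hγ hγ1 hr0 hq0 hq h) hx'
  have t2 := mul_lt_mul_of_pos_left (isoelastic_lt_tangent (q := 1 - q) hγ hγ1 (sub_pos.2 hr1)
    (by linarith) (fun e => hq (by linarith)) h') hy'
  have key : x * ((1 - r ^ (1 - γ)) / (1 - γ)) + y * ((1 - (1 - r) ^ (1 - γ)) / (1 - γ)) <
      x * ((1 - q ^ (1 - γ)) / (1 - γ)) + y * ((1 - (1 - q) ^ (1 - γ)) / (1 - γ)) := by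
    -- The value in `mul_optimalRatio_rpow` is symmetric in `x` and `y`, so the two marginal losses
    -- agree.
    have : x * r ^ (-γ) * (q - r) + y * (1 - r) ^ (-γ) * (1 - q - (1 - r)) = 0 := by
      rw [e1, e2]; ring
    linarith
  refine (ENNReal.ofReal_lt_ofReal_iff_of_nonneg ?_).2 key
  have h1 := real_loss_lower hγ hγ1 hr0.le (by simp [hr0.ne'])
  have h2 := real_loss_lower hγ hγ1 (sub_pos.2 hr1).le (by simp [(sub_pos.2 hr1).ne'])
  exact add_nonneg (mul_nonneg hx (by linarith)) (mul_nonneg hy (by linarith))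

lemma splitLoss_optimalRatio_le {γ x y q : ℝ} (hγ : 0 < γ) (hγ1 : γ ≠ 1) (hx : 0 ≤ x) (hy : 0 ≤ y)
    (hq0 : 0 ≤ q) (hq1 : q ≤ 1) :
    splitLoss γ x y (optimalRatio γ x y) ≤ splitLoss γ x y q := by
  rcases eq_or_ne q (optimalRatio γ x y) with rfl | h
  · rfl
  rcases (add_nonneg hx hy).eq_or_lt with h0 | h0
  · have hx0 : x = 0 := by linarith
    have hy0 : y = 0 := by linarith
    simp [splitLoss, hx0, hy0]
  · exact (splitLoss_optimalRatio_lt hγ hγ1 hx hy h0 hq0 hq1 h).le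

/-- Writing `r ^ (1 - γ) = r * r ^ (-γ)`, the first order condition turns the weighted powers into
`(r + (1 - r)) * S ^ γ`, where `S = x ^ (1 / γ) + y ^ (1 / γ)`. The closed form shows finiteness and
continuity of the minimum, which are hidden by products `0 * ⊤` in `splitLoss`. -/
lemma splitLoss_optimalRatio_eq {γ x y : ℝ} (hγ : 0 < γ) (hγ1 : γ ≠ 1) (hx : 0 ≤ x) (hy : 0 ≤ y) :
    splitLoss γ x y (optimalRatio γ x y) =
      ENNReal.ofReal ((x + y - (x ^ (1 / γ) + y ^ (1 / γ)) ^ γ) / (1 - γ)) := by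
  have hc : ∀ z : ℝ, 0 ≤ z → (z ^ (1 / γ)) ^ γ = z := fun z hz => by
    rw [← Real.rpow_mul hz, one_div_mul_cancel hγ.ne', Real.rpow_one]
  have h0 : (0 : ℝ) ^ (1 / γ) = 0 := Real.zero_rpow (by positivity)
  rcases hx.eq_or_lt with rfl | hx'
  · rw [optimalRatio_left_zero hγ]
    simp [splitLoss, loss_one, -one_div, h0, hc y hy]
  rcases hy.eq_or_lt with rfl | hy'
  · rw [optimalRatio_right_zero hγ hx']
    simp [splitLoss, loss_one, -one_div, h0, hc x hx]
  have hr0 := optimalRatio_pos (γ := γ) hx' hy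
  have hr1 := optimalRatio_lt_one (γ := γ) hx hy'
  have e1 := mul_optimalRatio_rpow hγ hx' hy
  have e2 := mul_optimalRatio_rpow hγ hy' hx
  rw [← one_sub_optimalRatio hx hy (by linarith), add_comm] at e2
  set r := optimalRatio γ x y
  rw [splitLoss_of_pos hγ hγ1 hx hy hr0.le hr1.le (by simp [hr0.ne'])
    (by simp [(sub_pos.2 hr1).ne'])]
  congr 1
  have hp : ∀ z : ℝ, 0 < z → z ^ (1 - γ) = z * z ^ (-γ) := fun z hz => by
    rw [sub_eq_add_neg, Real.rpow_add hz, Real.rpow_one]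
  rw [hp r hr0, hp (1 - r) (sub_pos.2 hr1)]
  have hne : 1 - γ ≠ 0 := sub_ne_zero.2 hγ1.symm
  field_simp
  linear_combination (-r) * e1 - (1 - r) * e2

lemma continuousAt_loss {γ q : ℝ} (hq : q ≠ 0) : ContinuousAt (loss γ) q := by
  have h : ContinuousAt (fun q : ℝ => ENNReal.ofReal ((1 - q ^ (1 - γ)) / (1 - γ))) q :=
    ENNReal.continuous_ofReal.continuousAt.comp
      ((continuousAt_const.sub (Real.continuousAt_rpow_const q (1 - γ) (Or.inl hq))).div_const _)
  refine h.congr ?_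
  filter_upwards [isOpen_ne.mem_nhds hq] with t ht
  rw [loss_of_not fun h => ht h.1]

lemma measurable_loss (γ : ℝ) : Measurable (loss γ) := by
  by_cases h : 1 < γ
  · have : loss γ = fun q => if q ∈ ({0} : Set ℝ) then ⊤ else
        ENNReal.ofReal ((1 - q ^ (1 - γ)) / (1 - γ)) := by
      funext q; simp [loss, h]
    rw [this]
    exact Measurable.ite (measurableSet_singleton 0) measurable_const (by fun_prop)
  · have : loss γ = fun q => ENNReal.ofReal ((1 - q ^ (1 - γ)) / (1 - γ)) := by
      funext q; simp [loss, h]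
    rw [this]
    fun_prop


/-! ### From extended real utilities to losses. -/

/-- Since `(D q)^(1-γ) = D^(1-γ) q^(1-γ)`, changing the unit of capital is a positive affine change
of utility; for `q = 0` and `γ > 1` both sides are `⊥`. -/
lemma isoelasticUtility_mul {γ D q : ℝ} (hγ : 0 < γ) (hγ1 : γ ≠ 1) (hD : 0 < D) (hq : 0 ≤ q)
    (hq1 : q ≤ 1) :
    isoelasticUtility γ (D * q) = (((D ^ (1 - γ) - 1) / (1 - γ) : ℝ) : EReal) -
      ((ENNReal.ofReal (D ^ (1 - γ)) * loss γ q : ℝ≥0∞) : EReal) := by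
  have hκ := Real.rpow_pos_of_pos hD (1 - γ)
  by_cases h : q = 0 ∧ 1 < γ
  · simp [isoelasticUtility, loss, h, ENNReal.mul_top, hκ]
  · have h1 := real_loss_lower hγ hγ1 hq h
    have hne : 1 - γ ≠ 0 := sub_ne_zero.2 hγ1.symm
    rw [isoelasticUtility, if_neg (by simpa [hD.ne'] using h), loss_of_not h,
      ← ENNReal.ofReal_mul hκ.le, EReal.coe_ennreal_ofReal,
      max_eq_left (mul_nonneg hκ.le (by linarith)), ← EReal.coe_sub, Real.mul_rpow hD.le hq]
    congr 1
    field_simp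
    ring

lemma isoelasticUtility_eq_neg_loss {γ q : ℝ} (hγ : 0 < γ) (hγ1 : γ ≠ 1) (hq : 0 ≤ q)
    (hq1 : q ≤ 1) : isoelasticUtility γ q = -(loss γ q : EReal) := by
  have := isoelasticUtility_mul hγ hγ1 one_pos hq hq1
  simpa using this

/-- The decomposition into positive and negative parts, rearranged so that only sums occur: it then
survives `h = ⊤` and can be integrated term by term. -/
lemma toENNReal_sub_add (c : ℝ) (h : ℝ≥0∞) :
    ((c : EReal) - (h : EReal)).toENNReal + (h + ENNReal.ofReal (-c)) =
      (-((c : EReal) - (h : EReal))).toENNReal + ENNReal.ofReal c := by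
  induction h with
  | top => simp
  | coe h =>
    have e : ((h : ℝ≥0∞) : EReal) = ((h : ℝ) : EReal) := rfl
    rw [e, ← EReal.coe_sub, ← EReal.coe_neg, EReal.real_coe_toENNReal, EReal.real_coe_toENNReal]
    rw [← ENNReal.ofReal_coe_nnreal (p := h)]
    rw [← ENNReal.toReal_eq_toReal_iff' (by finiteness) (by finiteness)]
    rw [ENNReal.toReal_add (by finiteness) (by finiteness),
      ENNReal.toReal_add (by finiteness) (by finiteness),
      ENNReal.toReal_add (by finiteness) (by finiteness)]
    simp only [ENNReal.toReal_ofReal']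
    have := h.2
    have h4 : max (h : ℝ) 0 = h := max_eq_left h.2
    rw [h4]
    have e1 := max_zero_sub_max_neg_zero_eq_self ((c : ℝ) - h)
    have e2 := max_zero_sub_max_neg_zero_eq_self (c : ℝ)
    linarith

lemma expectation_sub {α : Type*} [MeasurableSpace α] (μ : Measure α) [IsProbabilityMeasure μ]
    (c : ℝ) {h : α → ℝ≥0∞} (hh : Measurable h) :
    expectation μ (fun x => (c : EReal) - (h x : EReal)) =
      (c : EReal) - ((∫⁻ x, h x ∂μ : ℝ≥0∞) : EReal) := by
  have hm : Measurable fun x => (c : EReal) - (h x : EReal) :=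
    measurable_const.sub hh.coe_ereal_ennreal
  have key : ∫⁻ x, ((c : EReal) - (h x : EReal)).toENNReal ∂μ +
      (∫⁻ x, h x ∂μ + ENNReal.ofReal (-c)) =
      ∫⁻ x, (-((c : EReal) - (h x : EReal))).toENNReal ∂μ + ENNReal.ofReal c := by
    have e := lintegral_congr (μ := μ) fun x => toENNReal_sub_add c (h x)
    rw [lintegral_add_right _ (by fun_prop), lintegral_add_right _ (by fun_prop),
      lintegral_add_right _ (by fun_prop)] at e
    simpa using e
  -- The positive part is bounded by that of `c`, so `⊤ - ⊤` never arises in `expectation`.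
  have hfin : ∫⁻ x, ((c : EReal) - (h x : EReal)).toENNReal ∂μ ≤ ENNReal.ofReal c := by
    calc _ ≤ ∫⁻ _, ENNReal.ofReal c ∂μ := by
          refine lintegral_mono fun x => ?_
          rw [← EReal.real_coe_toENNReal]
          refine EReal.toENNReal_le_toENNReal ?_
          exact (EReal.sub_le_sub le_rfl (EReal.coe_ennreal_nonneg (h x))).trans (by simp)
      _ = _ := by simp
  rw [expectation]
  generalize ∫⁻ x, ((c : EReal) - (h x : EReal)).toENNReal ∂μ = A at *
  generalize ∫⁻ x, (-((c : EReal) - (h x : EReal))).toENNReal ∂μ = B at *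
  generalize ∫⁻ x, h x ∂μ = H at *
  have hA : A ≠ ⊤ := ne_top_of_le_ne_top ENNReal.ofReal_ne_top hfin
  by_cases hH : H = ⊤
  · subst hH
    have hB : B = ⊤ := by
      by_contra hB
      exact ENNReal.add_ne_top.2 ⟨hB, ENNReal.ofReal_ne_top⟩ (by rw [← key]; simp)
    simp [hB]
  · have hB : B ≠ ⊤ := by
      rintro rfl
      exact ENNReal.add_ne_top.2 ⟨hA, ENNReal.add_ne_top.2 ⟨hH, ENNReal.ofReal_ne_top⟩⟩
        (key.trans (by simp))
    have k := congrArg ENNReal.toReal key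
    rw [ENNReal.toReal_add hA (by finiteness), ENNReal.toReal_add hH (by finiteness),
      ENNReal.toReal_add hB (by finiteness)] at k
    simp only [ENNReal.toReal_ofReal'] at k
    have e2 := max_zero_sub_max_neg_zero_eq_self (c : ℝ)
    rw [← EReal.coe_ennreal_toReal hA, ← EReal.coe_ennreal_toReal hB,
      ← EReal.coe_ennreal_toReal hH, ← EReal.coe_sub, ← EReal.coe_sub]
    congr 1
    linarith

lemma coe_mul_sub_ennreal {s : ℝ} (hs : 0 ≤ s) (c : ℝ) (h : ℝ≥0∞) :
    (s : EReal) * ((c : EReal) - (h : EReal)) =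
      ((s * c : ℝ) : EReal) - ((ENNReal.ofReal s * h : ℝ≥0∞) : EReal) := by
  rw [EReal.mul_sub_of_nonneg_of_ne_top (EReal.coe_nonneg.2 hs) (EReal.coe_ne_top s),
    EReal.coe_mul, EReal.coe_ennreal_mul, EReal.coe_ennreal_ofReal, max_eq_left hs]

lemma sum_sub_ennreal {ι : Type*} (s : Finset ι) (r : ι → ℝ) (h : ι → ℝ≥0∞) :
    ∑ i ∈ s, ((r i : EReal) - (h i : EReal)) =
      ((∑ i ∈ s, r i : ℝ) : EReal) - ((∑ i ∈ s, h i : ℝ≥0∞) : EReal) := by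
  classical
  induction s using Finset.induction_on with
  | empty => simp
  | insert a s ha ih =>
    rw [Finset.sum_insert ha, Finset.sum_insert ha, Finset.sum_insert ha, ih]
    push_cast
    have h0 (x : ℝ≥0∞) : (x : EReal) ≠ ⊥ := EReal.coe_ennreal_ne_bot x
    rw [sub_eq_add_neg, sub_eq_add_neg, sub_eq_add_neg,
      EReal.neg_add (Or.inl (h0 _)) (Or.inr (EReal.coe_ennreal_ne_bot _)), add_add_add_comm,
      sub_eq_add_neg]

lemma coe_sub_ennreal_le_iff {c : ℝ} {x y : ℝ≥0∞} :
    (c : EReal) - (x : EReal) ≤ (c : EReal) - (y : EReal) ↔ y ≤ x := by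
  refine ⟨fun h => ?_, fun h => EReal.sub_le_sub le_rfl (by exact_mod_cast h)⟩
  by_contra! hlt
  have := EReal.sub_lt_sub_of_le_of_gt (le_refl (c : EReal))
    (EReal.coe_ennreal_lt_coe_ennreal_iff.2 hlt) (EReal.coe_ne_top c) (EReal.coe_ne_bot c)
  exact absurd h this.not_ge

/-! ### The game in terms of expected loss. -/

variable {N KA KB M : ℕ}

/-- The fraction of the maximal capital that Player 1 is left with. -/
def remainder (a₁ : Action₁ N M) : Action₂ KA KB M → ℝ
  | Sum.inl b => a₁.2 (observe a₁.1 b.1)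
  | Sum.inr b => 1 - (a₁.2 (observe a₁.1 b.1) : ℝ)

lemma remainder_mem (a₁ : Action₁ N M) (a₂ : Action₂ KA KB M) :
    0 ≤ remainder a₁ a₂ ∧ remainder a₁ a₂ ≤ 1 := by
  rcases a₂ with b | b
  · exact (a₁.2 (observe a₁.1 b.1)).2
  · have := (a₁.2 (observe a₁.1 b.1)).2
    exact ⟨sub_nonneg.2 this.2, sub_le_self _ this.1⟩

lemma measurable_remainder (a₂ : Action₂ KA KB M) :
    Measurable fun a₁ : Action₁ N M => remainder a₁ a₂ := by
  -- The coordinate of the policy that is read depends on the sampling; there are finitely many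
  -- samplings, so each can be treated separately.
  have hd (b : Fin M → Bool) :
      Measurable fun a₁ : Action₁ N M => ((a₁.2 (observe a₁.1 b) : unitInterval) : ℝ) :=
    measurable_subtype_coe.comp
      (measurable_from_prod_countable_right fun S => measurable_pi_apply (observe S b))
  rcases a₂ with b | b
  · exact hd b.1
  · exact measurable_const.sub (hd b.1)

/-- Player 1's expected loss of utility. -/
noncomputable def expectedLoss (γ : ℝ) (σ₁ : Measure (Action₁ N M))
    (σ₂ : Action₂ KA KB M → ℝ) : ℝ≥0∞ :=
  ∑ a₂, ENNReal.ofReal (σ₂ a₂) * ∫⁻ a₁, loss γ (remainder a₁ a₂) ∂σ₁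

lemma expectedUtility_eq {γ C : ℝ} (hγ : 0 < γ) (hγ1 : γ ≠ 1) (hC : 0 < C)
    (σ₁ : Measure (Action₁ N M)) [IsProbabilityMeasure σ₁] {σ₂ : Action₂ KA KB M → ℝ}
    (h₂ : σ₂ ∈ stdSimplex ℝ (Action₂ KA KB M)) :
    expectedUtility γ C σ₁ σ₂ = ((((2 * C) ^ (1 - γ) - 1) / (1 - γ) : ℝ) : EReal) -
      ((ENNReal.ofReal ((2 * C) ^ (1 - γ)) * expectedLoss γ σ₁ σ₂ : ℝ≥0∞) : EReal) := by
  have hD : 0 < 2 * C := by positivity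
  have hp (a₁ : Action₁ N M) (a₂ : Action₂ KA KB M) :
      payoff γ C a₁ a₂ = ((((2 * C) ^ (1 - γ) - 1) / (1 - γ) : ℝ) : EReal) -
        ((ENNReal.ofReal ((2 * C) ^ (1 - γ)) * loss γ (remainder a₁ a₂) : ℝ≥0∞) : EReal) := by
    have := isoelasticUtility_mul hγ hγ1 hD (remainder_mem a₁ a₂).1 (remainder_mem a₁ a₂).2
    rw [← this]
    rcases a₂ with b | b <;> rfl
  have hm (a₂ : Action₂ KA KB M) : Measurable fun a₁ : Action₁ N M => loss γ (remainder a₁ a₂) :=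
    (measurable_loss γ).comp (measurable_remainder a₂)
  simp only [expectedUtility, hp]
  have he (a₂ : Action₂ KA KB M) := expectation_sub σ₁ (((2 * C) ^ (1 - γ) - 1) / (1 - γ))
    ((hm a₂).const_mul (ENNReal.ofReal ((2 * C) ^ (1 - γ))))
  simp only [he, coe_mul_sub_ennreal (h₂.1 _)]
  rw [sum_sub_ennreal, ← Finset.sum_mul, h₂.2, one_mul]
  congr 2
  rw [expectedLoss, Finset.mul_sum]
  refine Finset.sum_congr rfl fun a₂ _ => ?_
  rw [lintegral_const_mul _ (hm a₂)]
  ring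

lemma expectedUtility_le_iff {γ C : ℝ} (hγ : 0 < γ) (hγ1 : γ ≠ 1) (hC : 0 < C)
    {σ₁ σ₁' : Measure (Action₁ N M)} (h₁ : IsProbabilityMeasure σ₁)
    (h₁' : IsProbabilityMeasure σ₁') {σ₂ σ₂' : Action₂ KA KB M → ℝ}
    (h₂ : σ₂ ∈ stdSimplex ℝ (Action₂ KA KB M)) (h₂' : σ₂' ∈ stdSimplex ℝ (Action₂ KA KB M)) :
    expectedUtility γ C σ₁ σ₂ ≤ expectedUtility γ C σ₁' σ₂' ↔
      expectedLoss γ σ₁' σ₂' ≤ expectedLoss γ σ₁ σ₂ := by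
  have hκ : 0 < (2 * C) ^ (1 - γ) := Real.rpow_pos_of_pos (by positivity) _
  rw [expectedUtility_eq hγ hγ1 hC σ₁ h₂, expectedUtility_eq hγ hγ1 hC σ₁' h₂',
    coe_sub_ennreal_le_iff]
  exact ENNReal.mul_le_mul_iff_right (by simpa using hκ) ENNReal.ofReal_ne_top

/-- Utility is a fixed constant minus a positive finite multiple of the loss, so all comparisons
reverse and `C` drops out. -/
lemma isNashEquilibrium_iff {γ C : ℝ} (hγ : 0 < γ) (hγ1 : γ ≠ 1) (hC : 0 < C)
    (σ₁ : Measure (Action₁ N M)) (σ₂ : Action₂ KA KB M → ℝ) :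
    IsNashEquilibrium γ C σ₁ σ₂ ↔ IsProbabilityMeasure σ₁ ∧
      σ₂ ∈ stdSimplex ℝ (Action₂ KA KB M) ∧
      (∀ σ₁' : Measure (Action₁ N M), IsProbabilityMeasure σ₁' →
        expectedLoss γ σ₁ σ₂ ≤ expectedLoss γ σ₁' σ₂) ∧
      ∀ σ₂' ∈ stdSimplex ℝ (Action₂ KA KB M), expectedLoss γ σ₁ σ₂' ≤ expectedLoss γ σ₁ σ₂ := by
  constructor
  · rintro ⟨h₁, h₂, o₁, o₂⟩
    exact ⟨h₁, h₂, fun σ h => (expectedUtility_le_iff hγ hγ1 hC h h₁ h₂ h₂).1 (o₁ σ h),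
      fun σ h => (expectedUtility_le_iff hγ hγ1 hC h₁ h₁ h₂ h).1 (o₂ σ h)⟩
  · rintro ⟨h₁, h₂, o₁, o₂⟩
    exact ⟨h₁, h₂, fun σ h => (expectedUtility_le_iff hγ hγ1 hC h h₁ h₂ h₂).2 (o₁ σ h),
      fun σ h => (expectedUtility_le_iff hγ hγ1 hC h₁ h₁ h₂ h).2 (o₂ σ h)⟩


/-! ### Counting samples, samplings and sequences. -/

lemma ones_observe {M N : ℕ} (S : Sampling M N) (b : Fin M → Bool) :
    ones (observe S b) = (S.1.filter fun i => b i = true).card := by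
  conv_rhs => rw [← Finset.map_orderEmbOfFin_univ S.1 S.2, Finset.filter_map, Finset.card_map]
  rfl

lemma ones_le {N : ℕ} (d : Fin N → Bool) : ones d ≤ N :=
  (Finset.card_filter_le _ _).trans (by simp)

lemma card_filter_ones (N k : ℕ) :
    (Finset.univ.filter fun d : Fin N → Bool => ones d = k).card = N.choose k := by
  have h : (Finset.univ.filter fun d : Fin N → Bool => ones d = k).card =
      (Finset.powersetCard k (Finset.univ : Finset (Fin N))).card := by
    refine Finset.card_nbij' (fun d => Finset.univ.filter fun i => d i = true)
      (fun A i => decide (i ∈ A)) ?_ ?_ ?_ ?_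
    · intro d hd
      simpa [ones, Finset.mem_powersetCard] using (Finset.mem_filter.1 hd).2
    · intro A hA
      refine Finset.mem_filter.2 ⟨Finset.mem_univ _, ?_⟩
      simpa [ones, Finset.mem_powersetCard] using hA
    · intro d _
      funext i
      simp
    · intro A _
      ext i
      simp
  simpa using h

lemma card_sequences (M K : ℕ) : Fintype.card (Sequences M K) = M.choose K := by
  rw [Fintype.card_subtype, card_filter_ones]

lemma card_sampling (M N : ℕ) : Fintype.card (Sampling M N) = M.choose N := by
  have : Fintype.card (Sampling M N) = Fintype.card {S : Finset (Fin M) // S.card = N} := rfl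
  rw [this, Fintype.card_finset_len, Fintype.card_fin]

/-- The number of samplings that observe `k` ones in a given sequence. -/
lemma card_samplings_observing {M N K k : ℕ} (b : Fin M → Bool) (hb : ones b = K) (hk : k ≤ N) :
    (Finset.univ.filter fun S : Sampling M N => ones (observe S b) = k).card =
      K.choose k * (M - K).choose (N - k) := by
  set T : Finset (Fin M) := Finset.univ.filter fun i => b i = true with hT
  have hTK : T.card = K := hb
  have hTc : Tᶜ.card = M - K := by rw [Finset.card_compl, hTK, Fintype.card_fin]
  rw [← hTc, ← hTK, ← Finset.card_powersetCard, ← Finset.card_powersetCard, ← Finset.card_product]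
  have hf (S : Sampling M N) : ones (observe S b) = (S.1 ∩ T).card := by
    rw [ones_observe]; congr 1; ext i; simp [hT]
  -- A sampling that sees `k` ones consists of `k` positions of ones and `N - k` positions of zeros,
  -- chosen independently.
  refine Finset.card_bij (fun S _ => (S.1 ∩ T, S.1 \ T)) ?_ ?_ ?_
  · intro S hS
    rw [Finset.mem_filter, hf] at hS
    have h1 := Finset.card_inter_add_card_sdiff S.1 T
    have h2 := S.2
    simp only [Finset.mem_product, Finset.mem_powersetCard]
    refine ⟨⟨Finset.inter_subset_right, hS.2⟩, ?_, by omega⟩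
    intro i hi
    simpa using (Finset.mem_sdiff.1 hi).2
  · intro S _ S' _ h
    rw [Prod.mk.injEq] at h
    apply Subtype.ext
    rw [← Finset.sdiff_union_inter S.1 T, ← Finset.sdiff_union_inter S'.1 T, h.1, h.2]
  · rintro ⟨A, B⟩ hAB
    simp only [Finset.mem_product, Finset.mem_powersetCard] at hAB
    obtain ⟨⟨hA, hAk⟩, hB, hBk⟩ := hAB
    have hd : Disjoint A B :=
      Finset.disjoint_of_subset_left hA (Finset.disjoint_of_subset_right hB disjoint_compl_right)
    have e1 : (A ∪ B) ∩ T = A := by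
      ext i
      have h1 := @hA i
      have h2 := @hB i
      simp only [Finset.mem_compl] at h2
      simp only [Finset.mem_inter, Finset.mem_union]
      tauto
    have e2 : (A ∪ B) \ T = B := by
      ext i
      have h1 := @hA i
      have h2 := @hB i
      simp only [Finset.mem_compl] at h2
      simp only [Finset.mem_sdiff, Finset.mem_union]
      tauto
    have hAB : (A ∪ B).card = N := by rw [Finset.card_union_of_disjoint hd]; omega
    let S : Sampling M N := ⟨A ∪ B, hAB⟩
    refine ⟨S, Finset.mem_filter.2 ⟨Finset.mem_univ _, ?_⟩, Prod.ext e1 e2⟩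
    exact (hf S).trans ((congrArg Finset.card e1).trans hAk)

/-- The number of sequences in which a given sampling observes a given sample. -/
lemma card_sequences_observed {M N K : ℕ} (S : Sampling M N) (d : Fin N → Bool)
    (hK : ones d ≤ K) :
    (Finset.univ.filter fun b : Sequences M K => observe S b.1 = d).card =
      (M - N).choose (K - ones d) := by
  have hSc : S.1ᶜ.card = M - N := by rw [Finset.card_compl, S.2, Fintype.card_fin]
  have hsplit (b : Fin M → Bool) : ones b =
      (S.1.filter fun i => b i = true).card + (S.1ᶜ.filter fun i => b i = true).card := by
    rw [ones, ← Finset.card_union_of_disjoint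
      (Finset.disjoint_filter_filter disjoint_compl_right), ← Finset.filter_union,
      Finset.union_compl]
  rw [← hSc, ← Finset.card_powersetCard]
  -- A sequence that shows `d` on `S` is determined by the positions of its remaining `K - ones d`
  -- ones outside `S`.
  refine Finset.card_bij (fun b _ => S.1ᶜ.filter fun i => b.1 i = true) ?_ ?_ ?_
  · intro b hb
    have h1 := hsplit b.1
    have h2 := b.2
    rw [← ones_observe, (Finset.mem_filter.1 hb).2] at h1
    rw [Finset.mem_powersetCard]
    exact ⟨Finset.filter_subset _ _, by omega⟩
  · intro b hb b' hb' h
    apply Subtype.ext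
    funext i
    by_cases hi : i ∈ S.1
    · obtain ⟨j, rfl⟩ : ∃ j, S.1.orderEmbOfFin S.2 j = i := by
        have : i ∈ Set.range (S.1.orderEmbOfFin S.2) := by
          rw [Finset.range_orderEmbOfFin]; exact hi
        exact this
      have h1 := congrFun (Finset.mem_filter.1 hb).2 j
      have h2 := congrFun (Finset.mem_filter.1 hb').2 j
      exact h1.trans h2.symm
    · have := Finset.ext_iff.1 h i
      simp only [Finset.mem_filter, Finset.mem_compl, hi, not_false_eq_true, true_and] at this
      exact Bool.eq_iff_iff.2 this
  · intro A hA
    rw [Finset.mem_powersetCard] at hA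
    let b : Fin M → Bool := fun i =>
      if h : i ∈ S.1 then d ((S.1.orderIsoOfFin S.2).symm ⟨i, h⟩) else decide (i ∈ A)
    have hbA : (S.1ᶜ.filter fun i => b i = true) = A := by
      ext i
      by_cases hi : i ∈ S.1
      · simpa [hi] using fun h => (Finset.mem_compl.1 (hA.1 h)) hi
      · simp [b, hi]
    have hobs : observe S b = d := by
      funext j
      have hm : S.1.orderEmbOfFin S.2 j ∈ S.1 := Finset.orderEmbOfFin_mem _ _ _
      simp only [observe, b, hm, dite_true]
      congr 1
      rw [OrderIso.symm_apply_eq]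
      rfl
    have hones : ones b = K := by
      rw [hsplit, ← ones_observe, hobs, hbA, hA.2]; omega
    exact ⟨⟨b, hones⟩, by simp [hobs], hbA⟩

/-- Both sides count the pairs of an `N`-set and a `K`-set of positions that meet in `k` points. The
proof compares factorials. -/
lemma choose_mul_choose_mul_choose {M N K k : ℕ} (hN : N ≤ M) (hK : K ≤ M) (hkN : k ≤ N)
    (hkK : k ≤ K) :
    (M - N).choose (K - k) * N.choose k * M.choose N =
      K.choose k * (M - K).choose (N - k) * M.choose K := by
  by_cases h : K - k ≤ M - N
  -- For such a pair, `k, i, j, l` are the sizes of the intersection, the two differences and the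
  -- complement of the union.
  · obtain ⟨i, rfl⟩ := Nat.exists_eq_add_of_le hkN
    obtain ⟨j, rfl⟩ := Nat.exists_eq_add_of_le hkK
    obtain ⟨l, rfl⟩ := Nat.exists_eq_add_of_le (show k + i + j ≤ M by omega)
    have e1 : k + i + j + l - (k + i) = j + l := by omega
    have e2 : k + i + j + l - (k + j) = i + l := by omega
    rw [e1, e2, Nat.add_sub_cancel_left, Nat.add_sub_cancel_left]
    have F (a b : ℕ) : (a + b).choose a * a.factorial * b.factorial = (a + b).factorial := by
      rw [Nat.choose_symm_add, Nat.add_choose_mul_factorial_mul_factorial]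
    have f1 := F j l
    have f2 := F k i
    have f3 := F (k + i) (j + l)
    have f4 := F k j
    have f5 := F i l
    have f6 := F (k + j) (i + l)
    rw [show k + i + (j + l) = k + i + j + l by ring] at f3
    rw [show k + j + (i + l) = k + i + j + l by ring] at f6
    rw [← f1, ← f2] at f3
    rw [← f4, ← f5] at f6
    have hpos : 0 < k.factorial * i.factorial * j.factorial * l.factorial := by positivity
    refine Nat.eq_of_mul_eq_mul_right hpos ?_
    linarith
  · rw [Nat.choose_eq_zero_of_lt (show M - N < K - k by omega),
      Nat.choose_eq_zero_of_lt (show M - K < N - k by omega)]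
    simp

/-- For a uniform sequence the probability of a sample depends only on its number of ones, and not
on `S`. -/
lemma card_sequences_observed_div {M N K : ℕ} (hN : N ≤ M) (hK : K ≤ M) (S : Sampling M N)
    (d : Fin N → Bool) :
    ((Finset.univ.filter fun b : Sequences M K => observe S b.1 = d).card : ℝ) / M.choose K =
      hypergeom N K M (ones d) / N.choose (ones d) := by
  have h1 : (0 : ℝ) < M.choose K := by exact_mod_cast Nat.choose_pos hK
  have h2 : (0 : ℝ) < M.choose N := by exact_mod_cast Nat.choose_pos hN
  have h3 : (0 : ℝ) < N.choose (ones d) := by exact_mod_cast Nat.choose_pos (ones_le d)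
  by_cases h : ones d ≤ K
  · rw [card_sequences_observed S d h, hypergeom]
    have := choose_mul_choose_mul_choose hN hK (ones_le d) h
    field_simp
    exact_mod_cast by linarith
  -- Here `K - ones d` would truncate to `0`, but no sequence with `K` ones shows more than `K` of
  -- them.
  · have h0 : (Finset.univ.filter fun b : Sequences M K => observe S b.1 = d) = ∅ := by
      rw [Finset.filter_eq_empty_iff]
      rintro b - rfl
      apply h
      rw [ones_observe]
      conv_rhs => rw [← b.2]
      exact Finset.card_le_card (Finset.filter_subset_filter _ (Finset.subset_univ _))
    rw [h0, hypergeom, Nat.choose_eq_zero_of_lt (not_le.1 h)]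
    simp

lemma hypergeom_pos_iff {N K M k : ℕ} (hN : N ≤ M) (hK : K ≤ M) (hk : k ≤ N) :
    0 < hypergeom N K M k ↔ k ∈ reachable N K M := by
  have h2 : (0 : ℝ) < M.choose N := by exact_mod_cast Nat.choose_pos hN
  have : 0 < hypergeom N K M k ↔ 0 < K.choose k * (M - K).choose (N - k) := by
    rw [hypergeom, div_pos_iff_of_pos_right h2]
    exact_mod_cast Iff.rfl
  simp only [this, CanonicallyOrderedAdd.mul_pos, Nat.pos_iff_ne_zero, ne_eq,
    Nat.choose_eq_zero_iff, reachable, Finset.mem_Icc]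
  omega

lemma sum_ones_eq {N : ℕ} (g : ℕ → ℝ≥0∞) :
    ∑ d : Fin N → Bool, g (ones d) = ∑ k ∈ Finset.range (N + 1), (N.choose k : ℝ≥0∞) * g k := by
  rw [← Finset.sum_fiberwise_of_maps_to (t := Finset.range (N + 1)) (g := ones)
    (fun d _ => Finset.mem_range_succ_iff.2 (ones_le d))]
  refine Finset.sum_congr rfl fun k _ => ?_
  rw [Finset.sum_congr rfl fun d hd => by rw [(Finset.mem_filter.1 hd).2], Finset.sum_const,
    card_filter_ones, nsmul_eq_mul]

/-- Sums over counts as sums over samples. -/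
lemma sum_range_eq_sum_samples {N : ℕ} (g : ℕ → ℝ≥0∞) :
    ∑ k ∈ Finset.range (N + 1), g k =
      ∑ d : Fin N → Bool, ENNReal.ofReal (1 / N.choose (ones d)) * g (ones d) := by
  rw [sum_ones_eq fun k => ENNReal.ofReal (1 / N.choose k) * g k]
  refine Finset.sum_congr rfl fun k hk => ?_
  have h : (0 : ℝ) < N.choose k := by
    exact_mod_cast Nat.choose_pos (Finset.mem_range_succ_iff.1 hk)
  rw [← mul_assoc, ← ENNReal.ofReal_natCast, ← ENNReal.ofReal_mul h.le, mul_one_div_cancel h.ne',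
    ENNReal.ofReal_one, one_mul]

/-- Group the samplings by the number of ones seen. Only `K` survives, so a uniform sampler makes
Player 2's choice among the sequences of one scenario irrelevant. -/
lemma average_samplings {M N K : ℕ} (hN : N ≤ M) (b : Fin M → Bool) (hb : ones b = K)
    (g : ℕ → ℝ≥0∞) :
    (Fintype.card (Sampling M N) : ℝ≥0∞)⁻¹ * ∑ S : Sampling M N, g (ones (observe S b)) =
      ∑ k ∈ Finset.range (N + 1), ENNReal.ofReal (hypergeom N K M k) * g k := by
  have hpos : 0 < M.choose N := Nat.choose_pos hN
  rw [← Finset.sum_fiberwise_of_maps_to (t := Finset.range (N + 1))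
    (g := fun S : Sampling M N => ones (observe S b))
    (fun d _ => Finset.mem_range_succ_iff.2 (ones_le _)), Finset.mul_sum]
  refine Finset.sum_congr rfl fun k hk => ?_
  rw [Finset.sum_congr rfl fun d hd => by rw [(Finset.mem_filter.1 hd).2], Finset.sum_const,
    card_samplings_observing b hb (Finset.mem_range_succ_iff.1 hk), nsmul_eq_mul, ← mul_assoc,
    card_sampling]
  congr 1
  rw [hypergeom, ENNReal.ofReal_div_of_pos (by exact_mod_cast hpos), div_eq_mul_inv, mul_comm]
  simp [ENNReal.ofReal_mul]

/-- The dual of `average_samplings`: the right side does not involve `S`, so uniform sequences make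
the choice of positions irrelevant. -/
lemma average_sequences {M N K : ℕ} (hN : N ≤ M) (hK : K ≤ M) (S : Sampling M N)
    (f : (Fin N → Bool) → ℝ≥0∞) :
    ENNReal.ofReal (1 / M.choose K) * ∑ b : Sequences M K, f (observe S b.1) =
      ∑ d, ENNReal.ofReal (1 / N.choose (ones d)) *
        (ENNReal.ofReal (hypergeom N K M (ones d)) * f d) := by
  rw [← Finset.sum_fiberwise (g := fun b : Sequences M K => observe S b.1), Finset.mul_sum]
  refine Finset.sum_congr rfl fun d _ => ?_
  rw [Finset.sum_congr rfl fun b hb => by rw [(Finset.mem_filter.1 hb).2], Finset.sum_const,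
    nsmul_eq_mul, ← mul_assoc, ← mul_assoc, ← ENNReal.ofReal_natCast,
    ← ENNReal.ofReal_mul (by positivity), ← ENNReal.ofReal_mul (by positivity),
    one_div_mul_eq_div, one_div_mul_eq_div, card_sequences_observed_div hN hK]

/-! ### Losses of the symmetric strategies. -/

instance : DiscreteMeasurableSpace (Sampling M N) := ⟨fun _ => trivial⟩

/-- The expected loss in scenario A of the symmetric strategy with portions `q`. -/
noncomputable def lossA (N KA M : ℕ) (γ : ℝ) (q : ℕ → unitInterval) : ℝ≥0∞ :=
  ∑ k ∈ Finset.range (N + 1), ENNReal.ofReal (hypergeom N KA M k) * loss γ (q k)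

/-- The expected loss in scenario B of the symmetric strategy with portions `q`. -/
noncomputable def lossB (N KB M : ℕ) (γ : ℝ) (q : ℕ → unitInterval) : ℝ≥0∞ :=
  ∑ k ∈ Finset.range (N + 1), ENNReal.ofReal (hypergeom N KB M k) * loss γ (1 - q k)

/-- The expected loss in the symmetric profile with parameters `P` and `q`. -/
noncomputable def symmetricLoss (N KA KB M : ℕ) (γ : ℝ) (P : unitInterval)
    (q : ℕ → unitInterval) : ℝ≥0∞ :=
  ∑ k ∈ Finset.range (N + 1),
    splitLoss γ (P * hypergeom N KA M k) ((1 - P) * hypergeom N KB M k) (q k)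

/-- The expected loss of a policy against the symmetric strategy of Player 2. -/
noncomputable def policyLoss (KA KB M : ℕ) (γ : ℝ) (P : unitInterval) (π : Policy N) : ℝ≥0∞ :=
  ∑ d, ENNReal.ofReal (1 / N.choose (ones d)) *
    splitLoss γ (P * hypergeom N KA M (ones d)) ((1 - P) * hypergeom N KB M (ones d)) (π d)

lemma symmetricLoss_eq_policyLoss (γ : ℝ) (P : unitInterval) (q : ℕ → unitInterval) :
    symmetricLoss N KA KB M γ P q = policyLoss KA KB M γ P fun d : Fin N → Bool => q (ones d) :=
  sum_range_eq_sum_samples fun k =>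
    splitLoss γ (P * hypergeom N KA M k) ((1 - P) * hypergeom N KB M k) (q k)

lemma symmetricLoss_eq (γ : ℝ) (P : unitInterval) (q : ℕ → unitInterval) :
    symmetricLoss N KA KB M γ P q = ENNReal.ofReal P * lossA N KA M γ q +
      ENNReal.ofReal (1 - P) * lossB N KB M γ q := by
  simp only [symmetricLoss, splitLoss, lossA, lossB, Finset.mul_sum, Finset.sum_add_distrib,
    ENNReal.ofReal_mul P.2.1, ENNReal.ofReal_mul (sub_nonneg.2 P.2.2), mul_assoc]

lemma lossA_congr {γ : ℝ} {q q' : ℕ → unitInterval} (hN : N ≤ M) (hKA : KA ≤ M)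
    (h : ∀ k ∈ reachable N KA M, q k = q' k) : lossA N KA M γ q = lossA N KA M γ q' := by
  refine Finset.sum_congr rfl fun k hk => ?_
  by_cases hr : k ∈ reachable N KA M
  · rw [h k hr]
  · rw [← hypergeom_pos_iff hN hKA (Finset.mem_range_succ_iff.1 hk)] at hr
    simp [ENNReal.ofReal_eq_zero.2 (not_lt.1 hr)]

lemma lossB_congr {γ : ℝ} {q q' : ℕ → unitInterval} (hN : N ≤ M) (hKB : KB ≤ M)
    (h : ∀ k ∈ reachable N KB M, q k = q' k) : lossB N KB M γ q = lossB N KB M γ q' := by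
  refine Finset.sum_congr rfl fun k hk => ?_
  by_cases hr : k ∈ reachable N KB M
  · rw [h k hr]
  · rw [← hypergeom_pos_iff hN hKB (Finset.mem_range_succ_iff.1 hk)] at hr
    simp [ENNReal.ofReal_eq_zero.2 (not_lt.1 hr)]

lemma isProbabilityMeasure_symmetricStrategy₁ (hN : N ≤ M) (q : ℕ → unitInterval) :
    IsProbabilityMeasure (symmetricStrategy₁ N M q) := by
  constructor
  have h : (Fintype.card (Sampling M N) : ℝ≥0∞) ≠ 0 := by
    rw [card_sampling]; exact_mod_cast (Nat.choose_pos hN).ne'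
  simp only [symmetricStrategy₁, Measure.smul_apply, Measure.finsetSum_apply, measure_univ,
    Finset.sum_const, Finset.card_univ, nsmul_eq_mul, mul_one, smul_eq_mul]
  exact ENNReal.inv_mul_cancel h (ENNReal.natCast_ne_top _)

lemma lintegral_symmetricStrategy₁ (q : ℕ → unitInterval) (f : Action₁ N M → ℝ≥0∞) :
    ∫⁻ a, f a ∂symmetricStrategy₁ N M q =
      (Fintype.card (Sampling M N) : ℝ≥0∞)⁻¹ *
        ∑ S : Sampling M N, f (S, fun d => q (ones d)) := by
  rw [symmetricStrategy₁, lintegral_smul_measure, lintegral_finsetSum_measure, smul_eq_mul]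
  simp

/-- Each of the finitely many pairs in the strategy carries positive mass. -/
lemma symmetricStrategy₁_ae {q : ℕ → unitInterval} {p : Action₁ N M → Prop}
    (h : ∀ᵐ a ∂symmetricStrategy₁ N M q, p a) (S : Sampling M N) : p (S, fun d => q (ones d)) := by
  rw [ae_iff, symmetricStrategy₁, Measure.smul_apply, Measure.finsetSum_apply, smul_eq_mul,
    mul_eq_zero] at h
  rcases h with h | h
  · simp at h
  · have := Finset.sum_eq_zero_iff.1 h S (Finset.mem_univ S)
    rw [Measure.dirac_apply] at this
    by_contra hp
    simp [hp] at this

lemma expectedLoss_symmetricStrategy₁ (hN : N ≤ M) (γ : ℝ) (q : ℕ → unitInterval)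
    {σ₂ : Action₂ KA KB M → ℝ} (h₂ : σ₂ ∈ stdSimplex ℝ (Action₂ KA KB M)) :
    expectedLoss γ (symmetricStrategy₁ N M q) σ₂ =
      ENNReal.ofReal (probScenarioA σ₂) * lossA N KA M γ q +
        ENNReal.ofReal (1 - probScenarioA σ₂) * lossB N KB M γ q := by
  have hB : 1 - probScenarioA σ₂ = ∑ b : Sequences M KB, σ₂ (Sum.inr b) := by
    have := h₂.2
    rw [Fintype.sum_sum_type] at this
    rw [probScenarioA]; linarith
  rw [hB, probScenarioA, ENNReal.ofReal_sum_of_nonneg fun b _ => h₂.1 _,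
    ENNReal.ofReal_sum_of_nonneg fun b _ => h₂.1 _, Finset.sum_mul, Finset.sum_mul, expectedLoss,
    Fintype.sum_sum_type]
  congr 1
  · refine Finset.sum_congr rfl fun b _ => ?_
    rw [lintegral_symmetricStrategy₁]
    congr 1
    exact average_samplings hN b.1 b.2 fun k => loss γ (q k)
  · refine Finset.sum_congr rfl fun b _ => ?_
    rw [lintegral_symmetricStrategy₁]
    congr 1
    exact average_samplings hN b.1 b.2 fun k => loss γ (1 - q k)

lemma probScenarioA_symmetricStrategy₂ (hKA : KA ≤ M) (P : unitInterval) :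
    probScenarioA (symmetricStrategy₂ KA KB M P) = P := by
  have h : (Fintype.card (Sequences M KA) : ℝ) ≠ 0 := by
    rw [card_sequences]; exact_mod_cast (Nat.choose_pos hKA).ne'
  simp only [probScenarioA, symmetricStrategy₂, Finset.sum_const, Finset.card_univ, nsmul_eq_mul]
  field_simp

lemma symmetricStrategy₂_mem (hKA : KA ≤ M) (hKB : KB ≤ M) (P : unitInterval) :
    symmetricStrategy₂ KA KB M P ∈ stdSimplex ℝ (Action₂ KA KB M) := by
  have h : (Fintype.card (Sequences M KB) : ℝ) ≠ 0 := by
    rw [card_sequences]; exact_mod_cast (Nat.choose_pos hKB).ne'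
  refine ⟨?_, ?_⟩
  · rintro (b | b)
    · exact div_nonneg P.2.1 (Nat.cast_nonneg _)
    · exact div_nonneg (sub_nonneg.2 P.2.2) (Nat.cast_nonneg _)
  · rw [Fintype.sum_sum_type]
    have := probScenarioA_symmetricStrategy₂ (KB := KB) hKA P
    rw [probScenarioA] at this
    rw [this]
    simp only [symmetricStrategy₂, Finset.sum_const, Finset.card_univ, nsmul_eq_mul]
    field_simp
    ring

lemma sum_symmetricStrategy₂ (hN : N ≤ M) (hKA : KA ≤ M) (hKB : KB ≤ M) (γ : ℝ)
    (P : unitInterval) (a : Action₁ N M) :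
    ∑ a₂, ENNReal.ofReal (symmetricStrategy₂ KA KB M P a₂) * loss γ (remainder a a₂) =
      policyLoss KA KB M γ P a.2 := by
  rw [Fintype.sum_sum_type]
  have hA := average_sequences hN hKA a.1 fun d => loss γ (a.2 d)
  have hB := average_sequences hN hKB a.1 fun d => loss γ (1 - a.2 d)
  have e1 : ∑ b : Sequences M KA, ENNReal.ofReal (symmetricStrategy₂ KA KB M P (Sum.inl b)) *
      loss γ (remainder (KB := KB) a (Sum.inl b)) = ENNReal.ofReal P *
        (ENNReal.ofReal (1 / M.choose KA) *
          ∑ b : Sequences M KA, loss γ (a.2 (observe a.1 b.1))) := by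
    rw [← mul_assoc, ← ENNReal.ofReal_mul P.2.1, Finset.mul_sum, mul_one_div,
      ← card_sequences M KA]
    rfl
  have e2 : ∑ b : Sequences M KB, ENNReal.ofReal (symmetricStrategy₂ KA KB M P (Sum.inr b)) *
      loss γ (remainder (KA := KA) a (Sum.inr b)) = ENNReal.ofReal (1 - P) *
        (ENNReal.ofReal (1 / M.choose KB) *
          ∑ b : Sequences M KB, loss γ (1 - a.2 (observe a.1 b.1))) := by
    rw [← mul_assoc, ← ENNReal.ofReal_mul (sub_nonneg.2 P.2.2), Finset.mul_sum, mul_one_div,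
      ← card_sequences M KB]
    rfl
  rw [e1, e2, hA, hB, policyLoss, Finset.mul_sum, Finset.mul_sum, ← Finset.sum_add_distrib]
  refine Finset.sum_congr rfl fun d _ => ?_
  rw [splitLoss, ENNReal.ofReal_mul P.2.1, ENNReal.ofReal_mul (sub_nonneg.2 P.2.2)]
  ring

lemma expectedLoss_symmetricStrategy₂ (hN : N ≤ M) (hKA : KA ≤ M) (hKB : KB ≤ M) (γ : ℝ)
    (P : unitInterval) (σ₁ : Measure (Action₁ N M)) :
    expectedLoss γ σ₁ (symmetricStrategy₂ KA KB M P) =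
      ∫⁻ a, policyLoss KA KB M γ P a.2 ∂σ₁ := by
  have hm (a₂ : Action₂ KA KB M) : Measurable fun a₁ : Action₁ N M => loss γ (remainder a₁ a₂) :=
    (measurable_loss γ).comp (measurable_remainder a₂)
  simp only [← sum_symmetricStrategy₂ hN hKA hKB]
  rw [lintegral_finsetSum _ fun a₂ _ => (hm a₂).const_mul _]
  exact Finset.sum_congr rfl fun a₂ _ => (lintegral_const_mul _ (hm a₂)).symm

lemma measurable_policyLoss (γ : ℝ) (P : unitInterval) :
    Measurable (policyLoss (N := N) KA KB M γ P) := by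
  refine Finset.measurable_sum _ fun d _ => Measurable.const_mul ?_ _
  have hd : Measurable fun π : Policy N => ((π d : unitInterval) : ℝ) :=
    measurable_subtype_coe.comp (measurable_pi_apply d)
  exact (((measurable_loss γ).comp hd).const_mul _).add
    (((measurable_loss γ).comp (measurable_const.sub hd)).const_mul _)

lemma expectedLoss_symmetric (hN : N ≤ M) (hKA : KA ≤ M) (hKB : KB ≤ M) (γ : ℝ)
    (P : unitInterval) (q : ℕ → unitInterval) :
    expectedLoss γ (symmetricStrategy₁ N M q) (symmetricStrategy₂ KA KB M P) =
      symmetricLoss N KA KB M γ P q := by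
  rw [expectedLoss_symmetricStrategy₁ hN γ q (symmetricStrategy₂_mem hKA hKB P),
    probScenarioA_symmetricStrategy₂ hKA, symmetricLoss_eq]

lemma equilibriumUtility_eq {γ : ℝ} (hγ : 0 < γ) (hγ1 : γ ≠ 1) (P : unitInterval) :
    equilibriumUtility N KA KB M γ P =
      ((0 : ℝ) : EReal) -
        (symmetricLoss N KA KB M γ P (splittingRatio N KA KB M γ P) : EReal) := by
  have hA (q : ℕ → unitInterval) : ∑ k ∈ Finset.range (N + 1),
      ((hypergeom N KA M k : ℝ) : EReal) * isoelasticUtility γ (q k : ℝ) =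
      ((0 : ℝ) : EReal) - (lossA N KA M γ q : EReal) := by
    have h := sum_sub_ennreal (Finset.range (N + 1)) (fun _ => 0) fun k =>
      ENNReal.ofReal (hypergeom N KA M k) * loss γ (q k)
    rw [Finset.sum_const_zero] at h
    rw [lossA, ← h]
    refine Finset.sum_congr rfl fun k _ => ?_
    have := coe_mul_sub_ennreal (hypergeom_nonneg N KA M k) 0 (loss γ (q k))
    rw [isoelasticUtility_eq_neg_loss hγ hγ1 (q k).2.1 (q k).2.2]
    simpa using this
  have hB (q : ℕ → unitInterval) : ∑ k ∈ Finset.range (N + 1),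
      ((hypergeom N KB M k : ℝ) : EReal) * isoelasticUtility γ (1 - (q k : ℝ)) =
      ((0 : ℝ) : EReal) - (lossB N KB M γ q : EReal) := by
    have h := sum_sub_ennreal (Finset.range (N + 1)) (fun _ => 0) fun k =>
      ENNReal.ofReal (hypergeom N KB M k) * loss γ (1 - q k)
    rw [Finset.sum_const_zero] at h
    rw [lossB, ← h]
    refine Finset.sum_congr rfl fun k _ => ?_
    have := coe_mul_sub_ennreal (hypergeom_nonneg N KB M k) 0 (loss γ (1 - q k))
    rw [isoelasticUtility_eq_neg_loss hγ hγ1 (sub_nonneg.2 (q k).2.2) (sub_le_self _ (q k).2.1)]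
    simpa using this
  rw [equilibriumUtility, hA, hB, coe_mul_sub_ennreal P.2.1,
    coe_mul_sub_ennreal (sub_nonneg.2 P.2.2), symmetricLoss_eq]
  have h := sum_sub_ennreal (Finset.univ : Finset Bool) (fun _ => 0) fun i =>
    if i then ENNReal.ofReal P * lossA N KA M γ (splittingRatio N KA KB M γ P) else
      ENNReal.ofReal (1 - P) * lossB N KB M γ (splittingRatio N KA KB M γ P)
  simpa using h

/-! ### The minimal symmetric loss as a function of `P`. -/

lemma sum_lt_sum_of_ne_top {ι : Type*} {s : Finset ι} {f g : ι → ℝ≥0∞} {i : ι}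
    (hi : i ∈ s) (hle : ∀ j ∈ s, f j ≤ g j) (hlt : f i < g i) (hf : ∑ j ∈ s, f j ≠ ⊤) :
    ∑ j ∈ s, f j < ∑ j ∈ s, g j := by
  classical
  rw [← Finset.add_sum_erase s f hi] at hf ⊢
  rw [← Finset.add_sum_erase s g hi]
  exact ENNReal.add_lt_add_of_lt_of_le (ENNReal.add_ne_top.1 hf).2 hlt
    (Finset.sum_le_sum fun j hj => hle j (Finset.mem_of_mem_erase hj))

lemma coe_splittingRatio (γ : ℝ) (P : unitInterval) (k : ℕ) :
    (splittingRatio N KA KB M γ P k : ℝ) =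
      optimalRatio γ (P * hypergeom N KA M k) ((1 - P) * hypergeom N KB M k) := rfl

lemma weight_nonneg (N K M k : ℕ) (P : unitInterval) :
    0 ≤ (P : ℝ) * hypergeom N K M k ∧ 0 ≤ (1 - (P : ℝ)) * hypergeom N K M k :=
  ⟨mul_nonneg P.2.1 (hypergeom_nonneg _ _ _ _),
    mul_nonneg (sub_nonneg.2 P.2.2) (hypergeom_nonneg _ _ _ _)⟩

lemma splitLoss_splittingRatio_le {γ : ℝ} (hγ : 0 < γ) (hγ1 : γ ≠ 1) (P q : unitInterval)
    (k : ℕ) :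
    splitLoss γ (P * hypergeom N KA M k) ((1 - P) * hypergeom N KB M k)
        (splittingRatio N KA KB M γ P k) ≤
      splitLoss γ (P * hypergeom N KA M k) ((1 - P) * hypergeom N KB M k) q :=
  splitLoss_optimalRatio_le hγ hγ1 (weight_nonneg ..).1 (weight_nonneg ..).2 q.2.1 q.2.2

lemma symmetricLoss_splittingRatio_le {γ : ℝ} (hγ : 0 < γ) (hγ1 : γ ≠ 1) (P : unitInterval)
    (q : ℕ → unitInterval) :
    symmetricLoss N KA KB M γ P (splittingRatio N KA KB M γ P) ≤ symmetricLoss N KA KB M γ P q :=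
  Finset.sum_le_sum fun k _ => splitLoss_splittingRatio_le hγ hγ1 P (q k) k

lemma symmetricLoss_splittingRatio_eq {γ : ℝ} (hγ : 0 < γ) (hγ1 : γ ≠ 1) (P : unitInterval) :
    symmetricLoss N KA KB M γ P (splittingRatio N KA KB M γ P) =
      ∑ k ∈ Finset.range (N + 1), ENNReal.ofReal
        ((P * hypergeom N KA M k + (1 - P) * hypergeom N KB M k -
          ((P * hypergeom N KA M k) ^ (1 / γ) + ((1 - P) * hypergeom N KB M k) ^ (1 / γ)) ^ γ) /
            (1 - γ)) :=
  Finset.sum_congr rfl fun _ _ =>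
    splitLoss_optimalRatio_eq hγ hγ1 (weight_nonneg ..).1 (weight_nonneg ..).2

lemma symmetricLoss_splittingRatio_ne_top {γ : ℝ} (hγ : 0 < γ) (hγ1 : γ ≠ 1) (P : unitInterval) :
    symmetricLoss N KA KB M γ P (splittingRatio N KA KB M γ P) ≠ ⊤ := by
  rw [symmetricLoss_splittingRatio_eq hγ hγ1]
  exact ENNReal.sum_ne_top.2 fun _ _ => ENNReal.ofReal_ne_top

/-- Read off from the closed form; in the defining sum a zero weight can meet an infinite loss at `P
= 0` or `P = 1` when `γ > 1`. -/
lemma continuous_symmetricLoss_splittingRatio {γ : ℝ} (hγ : 0 < γ) (hγ1 : γ ≠ 1) :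
    Continuous fun P => symmetricLoss N KA KB M γ P (splittingRatio N KA KB M γ P) := by
  simp only [symmetricLoss_splittingRatio_eq hγ hγ1]
  refine continuous_finsetSum _ fun k _ => ENNReal.continuous_ofReal.comp ?_
  have h1 : Continuous fun P : unitInterval => (P : ℝ) * hypergeom N KA M k := by fun_prop
  have h2 : Continuous fun P : unitInterval => (1 - (P : ℝ)) * hypergeom N KB M k := by fun_prop
  have hp : 0 ≤ 1 / γ := by positivity
  exact ((h1.add h2).sub (((h1.rpow_const fun _ => Or.inr hp).add
    (h2.rpow_const fun _ => Or.inr hp)).rpow_const fun _ => Or.inr hγ.le)).div_const _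

lemma symmetricLoss_zero {γ : ℝ} (hγ : 0 < γ) :
    symmetricLoss N KA KB M γ 0 (splittingRatio N KA KB M γ 0) = 0 := by
  refine Finset.sum_eq_zero fun k _ => ?_
  rw [coe_splittingRatio]
  simp [optimalRatio_left_zero hγ, splitLoss, loss_one]

lemma symmetricLoss_one {γ : ℝ} (hγ : 0 < γ) :
    symmetricLoss N KA KB M γ 1 (splittingRatio N KA KB M γ 1) = 0 := by
  refine Finset.sum_eq_zero fun k _ => ?_
  rw [coe_splittingRatio]
  rcases (hypergeom_nonneg N KA M k).eq_or_lt with h | h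
  · simp [splitLoss, ← h]
  · simp [splitLoss, optimalRatio_right_zero hγ h, loss_one]

lemma splittingRatio_pos {γ : ℝ} {P : unitInterval} {k : ℕ} (hP : 0 < P)
    (hk : 0 < hypergeom N KA M k) : 0 < (splittingRatio N KA KB M γ P k : ℝ) :=
  optimalRatio_pos (mul_pos hP hk) (weight_nonneg ..).2

lemma splittingRatio_lt_one {γ : ℝ} {P : unitInterval} {k : ℕ} (hP : P < 1)
    (hk : 0 < hypergeom N KB M k) : (splittingRatio N KA KB M γ P k : ℝ) < 1 :=
  optimalRatio_lt_one (weight_nonneg ..).1 (mul_pos (sub_pos.2 hP) hk)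

lemma symmetricLoss_splittingRatio_pos {γ : ℝ} (hγ : 0 < γ) (hγ1 : γ ≠ 1) {P : unitInterval}
    (hP : 0 < P) (hP1 : P < 1) {k : ℕ} (hk : k ≤ N) (hA : 0 < hypergeom N KA M k)
    (hB : 0 < hypergeom N KB M k) :
    0 < symmetricLoss N KA KB M γ P (splittingRatio N KA KB M γ P) := by
  have hr0 := splittingRatio_pos (KB := KB) (γ := γ) hP hA
  have hr1 := splittingRatio_lt_one (KA := KA) (γ := γ) hP1 hB
  refine lt_of_lt_of_le ?_ (Finset.single_le_sum (f := fun k =>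
    splitLoss γ (P * hypergeom N KA M k) ((1 - P) * hypergeom N KB M k)
      (splittingRatio N KA KB M γ P k)) (fun _ _ => zero_le) (Finset.mem_range_succ_iff.2 hk))
  refine add_pos_of_pos_of_nonneg (ENNReal.mul_pos ?_ (loss_pos hγ hγ1 hr0.le hr1).ne') zero_le
  exact (ENNReal.ofReal_pos.2 (mul_pos (show (0 : ℝ) < P from hP) hA)).ne'

/-- For a given ratio in `(0, 1)` the first order condition is a linear equation for `P`, with
positive coefficients on `P` and `1 - P`, so it has at most one solution. -/
lemma splittingRatio_injective {γ : ℝ} (hγ : 0 < γ) {P P' : unitInterval} (hP : 0 < P)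
    (hP1 : P < 1) {k : ℕ} (hA : 0 < hypergeom N KA M k) (hB : 0 < hypergeom N KB M k)
    (h : splittingRatio N KA KB M γ P' k = splittingRatio N KA KB M γ P k) : P' = P := by
  have hr0 := splittingRatio_pos (KB := KB) (γ := γ) hP hA
  have hr1 := splittingRatio_lt_one (KA := KA) (γ := γ) hP1 hB
  have key (Q : unitInterval) (hQ : 0 < (splittingRatio N KA KB M γ Q k : ℝ))
      (hQ1 : (splittingRatio N KA KB M γ Q k : ℝ) < 1) :
      (Q : ℝ) * (hypergeom N KA M k * (splittingRatio N KA KB M γ Q k : ℝ) ^ (-γ)) =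
        (1 - Q) * (hypergeom N KB M k * (1 - splittingRatio N KA KB M γ Q k : ℝ) ^ (-γ)) := by
    have hx := weight_nonneg N KA M k Q
    have hy := weight_nonneg N KB M k Q
    -- A ratio strictly between 0 and 1 forces both weights to be positive, which also covers `P'`
    -- at an endpoint.
    have hx' : 0 < (Q : ℝ) * hypergeom N KA M k := by
      refine hx.1.lt_of_ne fun h0 => ?_
      rw [coe_splittingRatio, ← h0, optimalRatio_left_zero hγ] at hQ
      exact hQ.false
    have hy' : 0 < (1 - (Q : ℝ)) * hypergeom N KB M k := by
      refine hy.2.lt_of_ne fun h0 => ?_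
      rw [coe_splittingRatio, ← h0, optimalRatio_right_zero hγ hx'] at hQ1
      exact hQ1.false
    rw [← mul_assoc, ← mul_assoc, coe_splittingRatio, mul_optimalRatio_rpow hγ hx' hy'.le,
      one_sub_optimalRatio hx'.le hy'.le (add_pos hx' hy'), mul_optimalRatio_rpow hγ hy' hx'.le,
      add_comm]
  have h1 := key P hr0 hr1
  have h2 := key P' (by rwa [h]) (by rwa [h])
  rw [h] at h2
  have hα := mul_pos hA (Real.rpow_pos_of_pos hr0 (-γ))
  have hβ := mul_pos hB (Real.rpow_pos_of_pos (sub_pos.2 hr1) (-γ))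
  apply Subtype.ext
  have : ((P' : ℝ) - P) * (hypergeom N KA M k * (splittingRatio N KA KB M γ P k : ℝ) ^ (-γ) +
      hypergeom N KB M k * (1 - splittingRatio N KA KB M γ P k : ℝ) ^ (-γ)) = 0 := by
    linear_combination h2 - h1
  rcases mul_eq_zero.1 this with h0 | h0 <;> linarith

/-- An infinite loss in A would enter the finite total loss with positive weight `P`. -/
lemma lossA_ne_top {γ : ℝ} (hγ : 0 < γ) (hγ1 : γ ≠ 1) {P : unitInterval} (hP : 0 < P) :
    lossA N KA M γ (splittingRatio N KA KB M γ P) ≠ ⊤ := fun h => by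
  refine symmetricLoss_splittingRatio_ne_top (N := N) (KA := KA) (KB := KB) (M := M) hγ hγ1 P ?_
  have hP' : ENNReal.ofReal P ≠ 0 := by simpa using hP
  rw [symmetricLoss_eq, h, ENNReal.mul_top hP', top_add]

lemma lossB_ne_top {γ : ℝ} (hγ : 0 < γ) (hγ1 : γ ≠ 1) {P : unitInterval} (hP : P < 1) :
    lossB N KB M γ (splittingRatio N KA KB M γ P) ≠ ⊤ := fun h => by
  refine symmetricLoss_splittingRatio_ne_top (N := N) (KA := KA) (KB := KB) (M := M) hγ hγ1 P ?_
  have hP' : ENNReal.ofReal (1 - P) ≠ 0 := by simpa using hP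
  rw [symmetricLoss_eq, h, ENNReal.mul_top hP', add_top]

lemma continuousAt_splittingRatio {γ : ℝ} (hγ : 0 < γ) {P : unitInterval} (hP : 0 < P)
    (hP1 : P < 1) {k : ℕ} (h : 0 < hypergeom N KA M k ∨ 0 < hypergeom N KB M k) :
    ContinuousAt (fun P => (splittingRatio N KA KB M γ P k : ℝ)) P := by
  have h1 : Continuous fun P : unitInterval => (P : ℝ) * hypergeom N KA M k := by fun_prop
  have h2 : Continuous fun P : unitInterval => (1 - (P : ℝ)) * hypergeom N KB M k := by fun_prop
  have hp : 0 ≤ 1 / γ := by positivity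
  have h1' := h1.rpow_const (p := 1 / γ) fun _ => Or.inr hp
  have h2' := h2.rpow_const (p := 1 / γ) fun _ => Or.inr hp
  refine h1'.continuousAt.div (h1'.add h2').continuousAt (rpow_sum_pos (weight_nonneg ..).1
    (weight_nonneg ..).2 ?_).ne'
  rcases h with h | h
  · exact add_pos_of_pos_of_nonneg (mul_pos hP h) (weight_nonneg ..).2
  · exact add_pos_of_nonneg_of_pos (weight_nonneg ..).1 (mul_pos (sub_pos.2 hP1) h)

lemma continuousAt_lossA {γ : ℝ} (hγ : 0 < γ) {P : unitInterval} (hP : 0 < P) (hP1 : P < 1) :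
    ContinuousAt (fun P => lossA N KA M γ (splittingRatio N KA KB M γ P)) P := by
  refine tendsto_finsetSum _ fun k _ => ?_
  rcases (hypergeom_nonneg N KA M k).eq_or_lt with h | h
  · simp [← h]
  · refine ENNReal.Tendsto.const_mul ?_ (Or.inr ENNReal.ofReal_ne_top)
    exact ContinuousAt.comp (g := loss γ) (continuousAt_loss (splittingRatio_pos hP h).ne')
      (continuousAt_splittingRatio hγ hP hP1 (Or.inl h))

lemma continuousAt_lossB {γ : ℝ} (hγ : 0 < γ) {P : unitInterval} (hP : 0 < P) (hP1 : P < 1) :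
    ContinuousAt (fun P => lossB N KB M γ (splittingRatio N KA KB M γ P)) P := by
  refine tendsto_finsetSum _ fun k _ => ?_
  rcases (hypergeom_nonneg N KB M k).eq_or_lt with h | h
  · simp [← h]
  · refine ENNReal.Tendsto.const_mul ?_ (Or.inr ENNReal.ofReal_ne_top)
    exact ContinuousAt.comp (g := loss γ)
      (continuousAt_loss (sub_pos.2 (splittingRatio_lt_one hP1 h)).ne')
      (continuousAt_const.sub (continuousAt_splittingRatio hγ hP hP1 (Or.inr h)))

/-- At an interior maximum of the symmetric loss, Player 1's loss is the same in both scenarios. -/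
lemma lossA_eq_lossB {γ : ℝ} (hγ : 0 < γ) (hγ1 : γ ≠ 1) {P : unitInterval} (hP : 0 < P)
    (hP1 : P < 1) (hmax : ∀ Q, symmetricLoss N KA KB M γ Q (splittingRatio N KA KB M γ Q) ≤
      symmetricLoss N KA KB M γ P (splittingRatio N KA KB M γ P)) :
    lossA N KA M γ (splittingRatio N KA KB M γ P) =
      lossB N KB M γ (splittingRatio N KA KB M γ P) := by
  -- With `a`, `b` the losses of `q_Q` in A and B: `Q a + (1-Q) b = F(Q) ≤ F(P) ≤ P a + (1-P) b`.
  -- This replaces differentiating `F`.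
  have key (Q : unitInterval) (hQ : 0 < Q) (hQ1 : Q < 1) : ((Q : ℝ) - P) *
      ((lossA N KA M γ (splittingRatio N KA KB M γ Q)).toReal -
        (lossB N KB M γ (splittingRatio N KA KB M γ Q)).toReal) ≤ 0 := by
    have h := (hmax Q).trans
      (symmetricLoss_splittingRatio_le hγ hγ1 P (splittingRatio N KA KB M γ Q))
    have hA := lossA_ne_top (N := N) (KA := KA) (KB := KB) (M := M) hγ hγ1 hQ
    have hB := lossB_ne_top (N := N) (KA := KA) (KB := KB) (M := M) hγ hγ1 hQ1
    rw [symmetricLoss_eq, symmetricLoss_eq,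
      ← ENNReal.toReal_le_toReal (by finiteness) (by finiteness),
      ENNReal.toReal_add (by finiteness) (by finiteness),
      ENNReal.toReal_add (by finiteness) (by finiteness)] at h
    simp only [ENNReal.toReal_mul, ENNReal.toReal_ofReal Q.2.1, ENNReal.toReal_ofReal P.2.1,
      ENNReal.toReal_ofReal (sub_nonneg.2 Q.2.2), ENNReal.toReal_ofReal (sub_nonneg.2 P.2.2)] at h
    linarith
  have hA := lossA_ne_top (N := N) (KA := KA) (KB := KB) (M := M) hγ hγ1 hP
  have hB := lossB_ne_top (N := N) (KA := KA) (KB := KB) (M := M) hγ hγ1 hP1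
  have hcont : ContinuousAt (fun Q => (lossA N KA M γ (splittingRatio N KA KB M γ Q)).toReal -
      (lossB N KB M γ (splittingRatio N KA KB M γ Q)).toReal) P :=
    (((ENNReal.tendsto_toReal hA).comp (continuousAt_lossA hγ hP hP1)).sub
      ((ENNReal.tendsto_toReal hB).comp (continuousAt_lossB hγ hP hP1)))
  -- The sign of `Q - P` fixes the sign of `a - b` on each side of `P`; the two one-sided limits
  -- then give `a = b` at `P`.
  have : Filter.NeBot (nhdsWithin P (Set.Ioi P)) := nhdsGT_neBot_of_exists_gt ⟨1, hP1⟩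
  have : Filter.NeBot (nhdsWithin P (Set.Iio P)) := nhdsLT_neBot_of_exists_lt ⟨0, hP⟩
  have h1 : (lossA N KA M γ (splittingRatio N KA KB M γ P)).toReal -
      (lossB N KB M γ (splittingRatio N KA KB M γ P)).toReal ≤ 0 := by
    refine le_of_tendsto (hcont.mono_left (nhdsWithin_le_nhds (s := Set.Ioi P))) ?_
    filter_upwards [self_mem_nhdsWithin, nhdsWithin_le_nhds (Iio_mem_nhds hP1)] with Q hQ hQ1
    have hQ' : (P : ℝ) < Q := hQ
    exact nonpos_of_mul_nonpos_right (key Q (hP.trans hQ) hQ1) (sub_pos.2 hQ')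
  have h2 : 0 ≤ (lossA N KA M γ (splittingRatio N KA KB M γ P)).toReal -
      (lossB N KB M γ (splittingRatio N KA KB M γ P)).toReal := by
    refine ge_of_tendsto (hcont.mono_left (nhdsWithin_le_nhds (s := Set.Iio P))) ?_
    filter_upwards [self_mem_nhdsWithin, nhdsWithin_le_nhds (Ioi_mem_nhds hP)] with Q hQ hQ0
    have hQ' : (Q : ℝ) < P := hQ
    have := key Q hQ0 (lt_trans hQ hP1)
    nlinarith
  rw [← ENNReal.toReal_eq_toReal_iff' hA hB]
  linarith

lemma symmetricLoss_of_lossA_eq_lossB {γ : ℝ} {q : ℕ → unitInterval}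
    (h : lossA N KA M γ q = lossB N KB M γ q) (P : unitInterval) :
    symmetricLoss N KA KB M γ P q = lossA N KA M γ q := by
  rw [symmetricLoss_eq, ← h, ← add_mul, ← ENNReal.ofReal_add P.2.1 (sub_nonneg.2 P.2.2)]
  simp

/-- The symmetric loss has an interior maximum, at which Player 1's loss is the same in both
scenarios, and no other maximum. -/
lemma exists_symmetricLoss_max (hN : N ≤ M) (hKA : KA ≤ M) (hKB : KB ≤ M)
    (hK : (reachable N KA M ∩ reachable N KB M).Nonempty) {γ : ℝ} (hγ : 0 < γ) (hγ1 : γ ≠ 1) :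
    ∃ P : unitInterval, 0 < P ∧ P < 1 ∧
      lossA N KA M γ (splittingRatio N KA KB M γ P) =
        lossB N KB M γ (splittingRatio N KA KB M γ P) ∧
      ∀ Q, Q ≠ P → symmetricLoss N KA KB M γ Q (splittingRatio N KA KB M γ Q) <
        symmetricLoss N KA KB M γ P (splittingRatio N KA KB M γ P) := by
  obtain ⟨k, hk⟩ := hK
  rw [Finset.mem_inter] at hk
  have hkN : k ≤ N := (Finset.mem_Icc.1 hk.1).2.trans (min_le_right _ _)
  have hA := (hypergeom_pos_iff hN hKA hkN).2 hk.1
  have hB := (hypergeom_pos_iff hN hKB hkN).2 hk.2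
  obtain ⟨P, -, hmax⟩ := isCompact_univ.exists_isMaxOn Set.univ_nonempty
    (continuous_symmetricLoss_splittingRatio (N := N) (KA := KA) (KB := KB) (M := M)
      hγ hγ1).continuousOn
  have hmax' : ∀ Q, symmetricLoss N KA KB M γ Q (splittingRatio N KA KB M γ Q) ≤
      symmetricLoss N KA KB M γ P (splittingRatio N KA KB M γ P) := fun Q => hmax (Set.mem_univ Q)
  obtain ⟨R, hR0, hR1⟩ := exists_between (zero_lt_one (α := unitInterval))
  have hpos := (symmetricLoss_splittingRatio_pos hγ hγ1 hR0 hR1 hkN hA hB).trans_le (hmax' R)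
  have hP0 : 0 < P := by
    refine (zero_le : 0 ≤ P).lt_of_ne ?_
    rintro rfl
    rw [symmetricLoss_zero hγ] at hpos
    exact hpos.false
  have hP1 : P < 1 := by
    refine unitInterval.le_one'.lt_of_ne ?_
    rintro rfl
    rw [symmetricLoss_one hγ] at hpos
    exact hpos.false
  have heq := lossA_eq_lossB hγ hγ1 hP0 hP1 hmax'
  refine ⟨P, hP0, hP1, heq, fun Q hQ => ?_⟩
  -- The equalising portions lose the same at `Q` as at `P`, so the two portions can be compared at
  -- the single parameter `Q`, where the minimiser at the common count `k` is unique.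
  rw [symmetricLoss_of_lossA_eq_lossB heq P, ← symmetricLoss_of_lossA_eq_lossB heq Q]
  refine sum_lt_sum_of_ne_top (Finset.mem_range_succ_iff.2 hkN)
    (fun j _ => splitLoss_splittingRatio_le hγ hγ1 Q _ j) ?_
    (symmetricLoss_splittingRatio_ne_top hγ hγ1 Q)
  refine splitLoss_optimalRatio_lt hγ hγ1 (weight_nonneg ..).1 (weight_nonneg ..).2 ?_
    (splittingRatio N KA KB M γ P k).2.1 (splittingRatio N KA KB M γ P k).2.2 fun h =>
      hQ (splittingRatio_injective hγ hP0 hP1 hA hB (Subtype.ext h).symm)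
  rcases (zero_le : 0 ≤ Q).eq_or_lt with h | h
  · simpa [← h] using hB
  · exact add_pos_of_pos_of_nonneg (mul_pos h hA) (weight_nonneg ..).2

/-! ### Nash equilibria. -/

lemma symmetricLoss_le_policyLoss {γ : ℝ} (hγ : 0 < γ) (hγ1 : γ ≠ 1) (P : unitInterval)
    (π : Policy N) :
    symmetricLoss N KA KB M γ P (splittingRatio N KA KB M γ P) ≤ policyLoss KA KB M γ P π := by
  rw [symmetricLoss_eq_policyLoss]
  exact Finset.sum_le_sum fun d _ =>
    mul_le_mul_right (splitLoss_splittingRatio_le hγ hγ1 P (π d) (ones d)) _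

/-- An optimal policy places the optimal portion at every sample that can occur. -/
lemma eq_splittingRatio_of_policyLoss (hN : N ≤ M) (hKA : KA ≤ M) (hKB : KB ≤ M) {γ : ℝ}
    (hγ : 0 < γ) (hγ1 : γ ≠ 1) {P : unitInterval} (hP : 0 < P) (hP1 : P < 1) {π : Policy N}
    (h : policyLoss KA KB M γ P π =
      symmetricLoss N KA KB M γ P (splittingRatio N KA KB M γ P))
    {d : Fin N → Bool} (hd : ones d ∈ reachable N KA M ∪ reachable N KB M) :
    π d = splittingRatio N KA KB M γ P (ones d) := by
  by_contra hne
  refine h.not_gt ?_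
  have hfin := symmetricLoss_splittingRatio_ne_top (N := N) (KA := KA) (KB := KB) (M := M)
    hγ hγ1 P
  rw [symmetricLoss_eq_policyLoss] at hfin ⊢
  refine sum_lt_sum_of_ne_top (Finset.mem_univ d) (fun d _ =>
    mul_le_mul_right (splitLoss_splittingRatio_le hγ hγ1 P (π d) (ones d)) _) ?_ hfin
  have hc : (0 : ℝ) < 1 / N.choose (ones d) := by
    have : (0 : ℝ) < N.choose (ones d) := by exact_mod_cast Nat.choose_pos (ones_le d)
    positivity
  refine (ENNReal.mul_lt_mul_iff_right (ENNReal.ofReal_pos.2 hc).ne' ENNReal.ofReal_ne_top).2 ?_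
  refine splitLoss_optimalRatio_lt hγ hγ1 (weight_nonneg ..).1 (weight_nonneg ..).2 ?_
    (π d).2.1 (π d).2.2 fun h => hne (Subtype.ext h)
  rw [Finset.mem_union, ← hypergeom_pos_iff hN hKA (ones_le d),
    ← hypergeom_pos_iff hN hKB (ones_le d)] at hd
  rcases hd with h | h
  · exact add_pos_of_pos_of_nonneg (mul_pos hP h) (weight_nonneg ..).2
  · exact add_pos_of_nonneg_of_pos (weight_nonneg ..).1 (mul_pos (sub_pos.2 hP1) h)

/-- Every Nash equilibrium has the parameters of the symmetric profile at an equalising maximum of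
the symmetric loss. -/
lemma IsNashEquilibrium.parameters (hN : N ≤ M) (hKA : KA ≤ M) (hKB : KB ≤ M) {γ C : ℝ}
    (hγ : 0 < γ) (hγ1 : γ ≠ 1) (hC : 0 < C) {P : unitInterval} (hP : 0 < P) (hP1 : P < 1)
    (heq : lossA N KA M γ (splittingRatio N KA KB M γ P) =
      lossB N KB M γ (splittingRatio N KA KB M γ P))
    (hmax : ∀ Q, Q ≠ P → symmetricLoss N KA KB M γ Q (splittingRatio N KA KB M γ Q) <
      symmetricLoss N KA KB M γ P (splittingRatio N KA KB M γ P))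
    {σ₁ : Measure (Action₁ N M)} {σ₂ : Action₂ KA KB M → ℝ} (h : IsNashEquilibrium γ C σ₁ σ₂) :
    probScenarioA σ₂ = P ∧ ∀ᵐ a ∂σ₁, ∀ d : Fin N → Bool,
      ones d ∈ reachable N KA M ∪ reachable N KB M →
        a.2 d = splittingRatio N KA KB M γ P (ones d) := by
  obtain ⟨h₁, h₂, o₁, o₂⟩ := (isNashEquilibrium_iff hγ hγ1 hC σ₁ σ₂).1 h
  have hp0 : 0 ≤ probScenarioA σ₂ := Finset.sum_nonneg fun b _ => h₂.1 _
  have hp1 : probScenarioA σ₂ ≤ 1 := by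
    rw [← h₂.2, Fintype.sum_sum_type]
    exact le_add_of_nonneg_right (Finset.sum_nonneg fun b _ => h₂.1 _)
  obtain ⟨Q, hQ⟩ : ∃ Q : unitInterval, (Q : ℝ) = probScenarioA σ₂ := ⟨⟨_, hp0, hp1⟩, rfl⟩
  have hs (q : ℕ → unitInterval) :
      expectedLoss γ (symmetricStrategy₁ N M q) σ₂ = symmetricLoss N KA KB M γ Q q := by
    rw [expectedLoss_symmetricStrategy₁ hN γ q h₂, symmetricLoss_eq, hQ]
  have hfin := symmetricLoss_splittingRatio_ne_top (N := N) (KA := KA) (KB := KB) (M := M)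
    hγ hγ1 P
  have hle (a : Action₁ N M) := symmetricLoss_le_policyLoss (KA := KA) (KB := KB) (M := M)
    hγ hγ1 P a.2
  have hint : symmetricLoss N KA KB M γ P (splittingRatio N KA KB M γ P) ≤
      ∫⁻ a, policyLoss KA KB M γ P a.2 ∂σ₁ := by
    calc _ = ∫⁻ _, symmetricLoss N KA KB M γ P (splittingRatio N KA KB M γ P) ∂σ₁ := by simp
      _ ≤ _ := lintegral_mono hle
  -- Each player is tested against deviations to symmetric strategies only: `hlow` bounds the
  -- equilibrium loss below by the loss against uniform sequences, `hup` bounds it above by `L(Q,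
  -- q)`.
  have hlow := o₂ _ (symmetricStrategy₂_mem hKA hKB P)
  rw [expectedLoss_symmetricStrategy₂ hN hKA hKB] at hlow
  have hup (q : ℕ → unitInterval) := o₁ _ (isProbabilityMeasure_symmetricStrategy₁ hN q)
  simp only [hs] at hup
  constructor
  · rw [← hQ]
    by_contra hne
    exact (hmax Q fun e => hne (congrArg _ e)).not_ge
      (hint.trans (hlow.trans (hup (splittingRatio N KA KB M γ Q))))
  -- This deviation loses exactly `F(P)`, whatever `σ₂` is. So the policy loss, pointwise at least
  -- `F(P)`, has integral at most `F(P)` and equals it almost everywhere.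
  · have hv := hup (splittingRatio N KA KB M γ P)
    rw [symmetricLoss_of_lossA_eq_lossB heq, ← symmetricLoss_of_lossA_eq_lossB heq P] at hv
    have hae := ae_eq_of_ae_le_of_lintegral_le (Filter.Eventually.of_forall hle) (by simpa)
      ((measurable_policyLoss γ P).comp measurable_snd).aemeasurable
      ((hlow.trans hv).trans_eq (by simp))
    filter_upwards [hae] with a ha d hd
    exact eq_splittingRatio_of_policyLoss hN hKA hKB hγ hγ1 hP hP1 ha.symm hd

/-- Player 2 is indifferent among all strategies because the portions equalise the scenarios, and
against uniform sequences no action of Player 1 loses less than the pointwise minimum. Portions at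
unreachable counts have weight zero. -/
lemma isNashEquilibrium_symmetric (hN : N ≤ M) (hKA : KA ≤ M) (hKB : KB ≤ M) {γ C : ℝ}
    (hγ : 0 < γ) (hγ1 : γ ≠ 1) (hC : 0 < C) {P : unitInterval}
    (heq : lossA N KA M γ (splittingRatio N KA KB M γ P) =
      lossB N KB M γ (splittingRatio N KA KB M γ P)) {q : ℕ → unitInterval}
    (hq : ∀ k ∈ reachable N KA M ∪ reachable N KB M, q k = splittingRatio N KA KB M γ P k) :
    IsNashEquilibrium γ C (symmetricStrategy₁ N M q) (symmetricStrategy₂ KA KB M P) := by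
  have hP := symmetricStrategy₂_mem hKA hKB P
  have eA := lossA_congr (γ := γ) hN hKA fun k hk => hq k (Finset.mem_union_left _ hk)
  have eB := lossB_congr (γ := γ) hN hKB fun k hk => hq k (Finset.mem_union_right _ hk)
  have hv (σ₂ : Action₂ KA KB M → ℝ) (h₂ : σ₂ ∈ stdSimplex ℝ (Action₂ KA KB M)) :
      expectedLoss γ (symmetricStrategy₁ N M q) σ₂ =
        symmetricLoss N KA KB M γ P (splittingRatio N KA KB M γ P) := by
    have hp0 : 0 ≤ probScenarioA σ₂ := Finset.sum_nonneg fun b _ => h₂.1 _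
    have hp1 : probScenarioA σ₂ ≤ 1 := by
      rw [← h₂.2, Fintype.sum_sum_type]
      exact le_add_of_nonneg_right (Finset.sum_nonneg fun b _ => h₂.1 _)
    rw [expectedLoss_symmetricStrategy₁ hN γ q h₂, eA, eB, ← heq, ← add_mul,
      ← ENNReal.ofReal_add hp0 (sub_nonneg.2 hp1), symmetricLoss_of_lossA_eq_lossB heq]
    simp
  refine (isNashEquilibrium_iff hγ hγ1 hC _ _).2
    ⟨isProbabilityMeasure_symmetricStrategy₁ hN q, hP, fun σ₁ h₁ => ?_, fun σ₂ h₂ => ?_⟩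
  · rw [hv _ hP, expectedLoss_symmetricStrategy₂ hN hKA hKB]
    calc _ = ∫⁻ _, symmetricLoss N KA KB M γ P (splittingRatio N KA KB M γ P) ∂σ₁ := by simp
      _ ≤ _ := lintegral_mono fun a => symmetricLoss_le_policyLoss hγ hγ1 P a.2
  · rw [hv _ hP, hv _ h₂]

lemma expectedUtility_symmetric (hN : N ≤ M) (hKA : KA ≤ M) (hKB : KB ≤ M) {γ C : ℝ}
    (hγ : 0 < γ) (hγ1 : γ ≠ 1) (hC : 0 < C) (P : unitInterval) :
    expectedUtility γ C (symmetricStrategy₁ N M (splittingRatio N KA KB M γ P))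
        (symmetricStrategy₂ KA KB M P) =
      (((2 * C) ^ (1 - γ) : ℝ) : EReal) * equilibriumUtility N KA KB M γ P +
        isoelasticUtility γ (2 * C) := by
  have hκ : 0 < (2 * C) ^ (1 - γ) := Real.rpow_pos_of_pos (by positivity) _
  have := isProbabilityMeasure_symmetricStrategy₁ hN (splittingRatio N KA KB M γ P)
  rw [expectedUtility_eq hγ hγ1 hC _ (symmetricStrategy₂_mem hKA hKB P),
    expectedLoss_symmetric hN hKA hKB, equilibriumUtility_eq hγ hγ1, coe_mul_sub_ennreal hκ.le,
    isoelasticUtility, if_neg (by simp [hC.ne'])]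
  simp [sub_eq_add_neg, add_comm]

lemma exists_ones_eq {N k : ℕ} (hk : k ≤ N) : ∃ d : Fin N → Bool, ones d = k := by
  have h : 0 < (Finset.univ.filter fun d : Fin N → Bool => ones d = k).card := by
    rw [card_filter_ones]; exact Nat.choose_pos hk
  obtain ⟨d, hd⟩ := Finset.card_pos.1 h
  exact ⟨d, (Finset.mem_filter.1 hd).2⟩

end StatisticalGame

theorem mainTheorem3 (N KA KB M : ℕ) (γ C : ℝ) (hN : N ≤ M) (hKAB : KA ≤ KB) (hKB : KB ≤ M)
    (hK : (StatisticalGame.reachable N KA M ∩ StatisticalGame.reachable N KB M).Nonempty)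
    (hγ : 0 < γ) (hγ1 : γ ≠ 1) (hC : 0 < C) :
    ∃ Pstar : unitInterval, 0 < Pstar ∧ Pstar < 1 ∧
      -- `Pstar` is the unique minimiser of `U_γ` on `[0, 1]`
      (∀ P : unitInterval, P ≠ Pstar →
        StatisticalGame.equilibriumUtility N KA KB M γ Pstar <
          StatisticalGame.equilibriumUtility N KA KB M γ P) ∧
      -- `U_γ(P)` is the expected utility of the symmetric profile with parameters `P`, `p'_k(P)`,
      -- up to the positive affine change of utility caused by the unit of capital
      (∀ P : unitInterval,
        StatisticalGame.expectedUtility γ C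
            (StatisticalGame.symmetricStrategy₁ N M (StatisticalGame.splittingRatio N KA KB M γ P))
            (StatisticalGame.symmetricStrategy₂ KA KB M P) =
          (((2 * C) ^ (1 - γ) : ℝ) : EReal) * StatisticalGame.equilibriumUtility N KA KB M γ P +
            StatisticalGame.isoelasticUtility γ (2 * C)) ∧
      -- there is exactly one Nash equilibrium of the symmetric form (portions at counts that no
      -- sequence can produce are irrelevant), and its parameters are `Pstar` and `p'_k(Pstar)`
      (∀ (P : unitInterval) (q : ℕ → unitInterval),
        StatisticalGame.IsNashEquilibrium γ C (StatisticalGame.symmetricStrategy₁ N M q)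
            (StatisticalGame.symmetricStrategy₂ KA KB M P) ↔
          P = Pstar ∧
            ∀ k ∈ StatisticalGame.reachable N KA M ∪ StatisticalGame.reachable N KB M,
              q k = StatisticalGame.splittingRatio N KA KB M γ Pstar k) ∧
      -- every Nash equilibrium in mixed strategies, symmetric or not, has the same parameters
      (∀ (σ₁ : MeasureTheory.Measure (StatisticalGame.Action₁ N M))
          (σ₂ : StatisticalGame.Action₂ KA KB M → ℝ),
        StatisticalGame.IsNashEquilibrium γ C σ₁ σ₂ →
          StatisticalGame.probScenarioA σ₂ = Pstar ∧
            ∀ᵐ a ∂σ₁, ∀ d : Fin N → Bool,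
              StatisticalGame.ones d ∈
                  StatisticalGame.reachable N KA M ∪ StatisticalGame.reachable N KB M →
                a.2 d = StatisticalGame.splittingRatio N KA KB M γ Pstar
                  (StatisticalGame.ones d)) := by
  have hKA : KA ≤ M := hKAB.trans hKB
  obtain ⟨P, hP, hP1, heq, hmax⟩ := StatisticalGame.exists_symmetricLoss_max hN hKA hKB hK hγ hγ1
  have hnash {σ₁ : MeasureTheory.Measure (StatisticalGame.Action₁ N M)}
      {σ₂ : StatisticalGame.Action₂ KA KB M → ℝ}
      (h : StatisticalGame.IsNashEquilibrium γ C σ₁ σ₂) :=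
    h.parameters hN hKA hKB hγ hγ1 hC hP hP1 heq hmax
  refine ⟨P, hP, hP1, fun Q hQ => ?_,
    fun Q => StatisticalGame.expectedUtility_symmetric hN hKA hKB hγ hγ1 hC Q,
    fun Q q => ⟨fun h => ?_, ?_⟩, fun σ₁ σ₂ h => hnash h⟩
  -- `U_γ` is minus the minimal loss, so its unique minimiser is the unique maximiser of that loss.
  · rw [StatisticalGame.equilibriumUtility_eq hγ hγ1, StatisticalGame.equilibriumUtility_eq hγ hγ1,
      ← not_le, StatisticalGame.coe_sub_ennreal_le_iff, not_le]
    exact hmax Q hQ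
  · obtain ⟨h1, h2⟩ := hnash h
    rw [StatisticalGame.probScenarioA_symmetricStrategy₂ hKA] at h1
    refine ⟨Subtype.ext h1, fun k hk => ?_⟩
    have hkN : k ≤ N := by
      rcases Finset.mem_union.1 hk with h | h <;>
        exact (Finset.mem_Icc.1 h).2.trans (min_le_right _ _)
    -- A sample with `k` ones and any one sampling turn the almost sure statement about policies
    -- into one about `q k`.
    obtain ⟨d, rfl⟩ := StatisticalGame.exists_ones_eq hkN
    have hS : 0 < Fintype.card (StatisticalGame.Sampling M N) := by
      rw [StatisticalGame.card_sampling]; exact Nat.choose_pos hN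
    obtain ⟨S⟩ := Fintype.card_pos_iff.1 hS
    exact StatisticalGame.symmetricStrategy₁_ae h2 S d hk
  · rintro ⟨rfl, hq⟩
    exact StatisticalGame.isNashEquilibrium_symmetric hN hKA hKB hγ hγ1 hC heq hq
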